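/- Let $E=[E_{ijk}]_{i,j,k=1}^{3}$ be an array of complex numbers with $E_{ijk}\neq 0$ if and only if $(i,j,k)$ is a permutation of $(1,2,3)$. For $l\neq n$ let $$\mathrm{co}(l,n)=\frac{E_{jln}}{E_{jnl}}\,\frac{E_{nlj}}{E_{lnj}},\qquad \{j,l,n\}=\{1,2,3\}.$$ Let $\mathsf A$ be the universal unital $C^*$-algebra generated by the entries of a matrix $u=[u_{jk}]_{j,k=1}^3$ subject to $$\sum_{s}u_{js}u_{ks}^*=\delta_{jk}1=\sum_s u_{sj}^*u_{sk},\qquad \sum_{i,j,k}E_{ijk}\,u_{ai}u_{bj}u_{ck}=E_{abc}\,1\quad(1\le a,b,c\le 3),$$ with comultiplication $\Delta(u_{jk})=\sum_s u_{js}\otimes u_{sk}$; the compact quantum group $\mathbb G=(\mathsf A,u)$ is the PW-quantum group related to $E$. For $q=|q|e^{\mathrm i t}\in\mathbb C\setminus\{0\}$ let $U_q(2)$ be the compact quantum group whose $C^*$-algebra is the universal unital $C^*$-algebra generated by $a,c,v$ with relations $$ac=\bar q\,ca,\quad ac^*=q\,c^*a,\quad a^*a+c^*c=1,\quad aa^*+|q|^2c^*c=1,\quad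 cc^*=c^*c,$$ $$vv^*=v^*v=1,\quad av=va,\quad cv=e^{-2\mathrm i t}vc,$$ with fundamental corepresentation $$\begin{pmatrix} v&0&0\\ 0&a&-q\,c^*v^*\\ 0&c&a^*v^*\end{pmatrix}.$$ Let $C(\mathbb T^2)$ denote the quantum version of the two-dimensional torus, i.e. the algebra of continuous functions on $\mathbb T^2$ with $\Delta(f)(g,g')=f(gg')$. Two compact quantum groups are isomorphic if there is a $*$-isomorphism of their $C^*$-algebras that intertwines the comultiplications, which take values in the minimal tensor product. If $\mathrm{co}(2,3)=1$ and $\mathrm{co}(1,3)\neq 1$, then $\mathbb G$ is isomorphic to $U_q(2)$ for some $q\in\mathbb C\setminus\{0\}$, or to $C(\mathbb T^2)$. -/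

import Mathlib

open scoped TensorProduct ComplexConjugate

noncomputable section

namespace PWQuantum

universe u v w

/-! ### C*-seminorms and C*-completions of unital complex *-algebras -/

section CStarSeminorm

/-- A C*-seminorm on a unital complex `*`-algebra: a submultiplicative seminorm with
`p (x* x) = p x ^ 2`. -/
structure CStarSeminorm (F : Type u) [Ring F] [StarRing F] [Algebra ℂ F] extends
    Seminorm ℂ F where
  mul_le' : ∀ x y, toFun (x * y) ≤ toFun x * toFun y
  star_mul_self' : ∀ x, toFun (star x * x) = toFun x ^ 2

variable {F : Type u} [Ring F] [StarRing F] [Algebra ℂ F]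

namespace CStarSeminorm

instance : CoeFun (CStarSeminorm F) (fun _ => F → ℝ) := ⟨fun p => p.toSeminorm⟩

theorem mul_le (p : CStarSeminorm F) (x y : F) : p (x * y) ≤ p x * p y := p.mul_le' x y

theorem star_mul_self (p : CStarSeminorm F) (x : F) : p (star x * x) = p x ^ 2 :=
  p.star_mul_self' x

theorem nonneg (p : CStarSeminorm F) (x : F) : 0 ≤ p x := apply_nonneg p.toSeminorm x

theorem le_star (p : CStarSeminorm F) (x : F) : p x ≤ p (star x) := by
  rcases (p.nonneg x).eq_or_lt with h | h
  · rw [← h]; exact p.nonneg _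
  · have h1 := p.star_mul_self x
    have h2 := p.mul_le (star x) x
    rw [h1, sq] at h2
    exact le_of_mul_le_mul_right h2 h

theorem star_eq (p : CStarSeminorm F) (x : F) : p (star x) = p x :=
  le_antisymm (by simpa using p.le_star (star x)) (p.le_star x)

theorem one_le (p : CStarSeminorm F) : p 1 ≤ 1 := by
  have h := p.star_mul_self 1
  simp only [star_one, one_mul] at h
  nlinarith [p.nonneg 1]

/-- The zero C*-seminorm. -/
def zero : CStarSeminorm F where
  toSeminorm := 0
  mul_le' x y := by
    show (0 : Seminorm ℂ F) _ ≤ (0 : Seminorm ℂ F) _ * (0 : Seminorm ℂ F) _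
    simp
  star_mul_self' x := by
    show (0 : Seminorm ℂ F) _ = (0 : Seminorm ℂ F) _ ^ 2
    simp

/-- The pointwise supremum of a nonempty pointwise bounded family of C*-seminorms. -/
def iSup {ι : Type w} [Nonempty ι] (p : ι → CStarSeminorm F)
    (hb : ∀ x, BddAbove (Set.range fun i => p i x)) : CStarSeminorm F where
  toFun x := ⨆ i, p i x
  map_zero' := by simp
  add_le' x y := ciSup_le fun i => (map_add_le_add (p i).toSeminorm x y).trans
    (add_le_add (le_ciSup (hb x) i) (le_ciSup (hb y) i))
  neg' x := by simp
  smul' c x := by simp [map_smul_eq_mul, Real.mul_iSup_of_nonneg]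
  mul_le' x y := ciSup_le fun i => ((p i).mul_le x y).trans
    (mul_le_mul (le_ciSup (hb x) i) (le_ciSup (hb y) i) ((p i).nonneg y)
      (((p i).nonneg x).trans (le_ciSup (hb x) i)))
  star_mul_self' x := by
    have hnn : 0 ≤ ⨆ i, p i x := Real.iSup_nonneg fun i => (p i).nonneg x
    apply le_antisymm
    · refine ciSup_le fun i => ?_
      rw [(p i).star_mul_self x]
      exact pow_le_pow_left₀ ((p i).nonneg x) (le_ciSup (hb x) i) 2
    · rw [← Real.le_sqrt hnn (Real.iSup_nonneg fun i => (p i).nonneg _)]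
      refine ciSup_le fun i => ?_
      apply Real.le_sqrt_of_sq_le
      rw [← (p i).star_mul_self x]
      exact le_ciSup (hb (star x * x)) i

/-- The `*`-algebra `F`, regarded as a seminormed algebra through `p`. -/
def Space (_p : CStarSeminorm F) : Type u := F

variable (p : CStarSeminorm F)

instance : SeminormedRing p.Space where
  __ := (inferInstanceAs (Ring F) : Ring p.Space)
  __ := (p.toSeminorm.toSeminormedAddCommGroup : SeminormedAddCommGroup F)
  norm_mul_le x y := p.mul_le x y

instance : StarRing p.Space := inferInstanceAs (StarRing F)
instance : Algebra ℂ p.Space := inferInstanceAs (Algebra ℂ F)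
instance [StarModule ℂ F] : StarModule ℂ p.Space := inferInstanceAs (StarModule ℂ F)

theorem norm_def (x : p.Space) : ‖x‖ = p x := rfl

instance : NormedAlgebra ℂ p.Space where
  norm_smul_le c x := (map_smul_eq_mul p.toSeminorm c x).le

instance : NormedStarGroup p.Space where
  norm_star_le x := (p.star_eq x).le

/-- The C*-completion of `F` for the C*-seminorm `p`: the Hausdorff completion of `F`. -/
def Completion : Type u := UniformSpace.Completion p.Space

namespace Completion

instance : NormedRing p.Completion := inferInstanceAs (NormedRing (UniformSpace.Completion p.Space))
instance : CompleteSpace p.Completion :=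
  inferInstanceAs (CompleteSpace (UniformSpace.Completion p.Space))
instance : Algebra ℂ p.Completion :=
  inferInstanceAs (Algebra ℂ (UniformSpace.Completion p.Space))

instance : NormedAlgebra ℂ p.Completion where
  norm_smul_le c x :=
    (norm_smul_le (α := ℂ) (β := UniformSpace.Completion p.Space) c x)

/-- The canonical map of `F` to its completion. -/
def coe (x : F) : p.Completion := ((show p.Space from x : p.Space) : UniformSpace.Completion p.Space)

theorem norm_coe (x : F) : ‖coe p x‖ = p x := UniformSpace.Completion.norm_coe (E := p.Space) x

theorem denseRange_coe : DenseRange (coe p) :=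
  UniformSpace.Completion.denseRange_coe (α := p.Space)

theorem coe_mul (x y : F) : coe p (x * y) = coe p x * coe p y :=
  UniformSpace.Completion.coe_mul (α := p.Space) x y

theorem coe_add (x y : F) : coe p (x + y) = coe p x + coe p y :=
  UniformSpace.Completion.coe_add (α := p.Space) x y

theorem coe_smul (c : ℂ) (x : F) : coe p (c • x) = c • coe p x :=
  UniformSpace.Completion.coe_smul (X := p.Space) c x

instance : Star p.Completion :=
  ⟨UniformSpace.Completion.map (star : p.Space → p.Space)⟩

theorem star_coe (x : F) : star (coe p x) = coe p (star x) :=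
  UniformSpace.Completion.map_coe (α := p.Space) (β := p.Space)
    (star_isometry (E := p.Space)).uniformContinuous x

theorem continuous_star' : Continuous (star : p.Completion → p.Completion) :=
  UniformSpace.Completion.continuous_map

theorem ext_fun {Y : Type v} [TopologicalSpace Y] [T2Space Y] {f g : p.Completion → Y}
    (hf : Continuous f) (hg : Continuous g) (h : ∀ y : F, f (coe p y) = g (coe p y))
    (x : p.Completion) : f x = g x :=
  congrFun ((denseRange_coe p).equalizer hf hg (funext h)) x

theorem ext_fun₂ {Y : Type v} [TopologicalSpace Y] [T2Space Y]
    {f g : p.Completion × p.Completion → Y} (hf : Continuous f) (hg : Continuous g)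
    (h : ∀ y z : F, f (coe p y, coe p z) = g (coe p y, coe p z)) (x : p.Completion × p.Completion) :
    f x = g x :=
  congrFun (((denseRange_coe p).prodMap (denseRange_coe p)).equalizer hf hg
    (funext fun z => h z.1 z.2)) x

instance : StarRing p.Completion where
  star_involutive x :=
    ext_fun p (f := fun x => star (star x)) (g := fun x => x)
      ((continuous_star' p).comp (continuous_star' p)) continuous_id
      (fun y => by simp only [star_coe, star_star]) x
  star_mul x y :=
    ext_fun₂ p (f := fun z => star (z.1 * z.2)) (g := fun z => star z.2 * star z.1)
      ((continuous_star' p).comp (continuous_fst.mul continuous_snd))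
      (((continuous_star' p).comp continuous_snd).mul ((continuous_star' p).comp continuous_fst))
      (fun y z => by simp only [← coe_mul, star_coe, star_mul]) (x, y)
  star_add x y :=
    ext_fun₂ p (f := fun z => star (z.1 + z.2)) (g := fun z => star z.1 + star z.2)
      ((continuous_star' p).comp (continuous_fst.add continuous_snd))
      (((continuous_star' p).comp continuous_fst).add ((continuous_star' p).comp continuous_snd))
      (fun y z => by simp only [← coe_add, star_coe, star_add]) (x, y)

instance : CStarRing p.Completion where
  norm_mul_self_le x := le_of_eq <|
    ext_fun p (f := fun x => ‖x‖ * ‖x‖) (g := fun x => ‖star x * x‖)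
      (continuous_norm.mul continuous_norm)
      (continuous_norm.comp ((continuous_star' p).mul continuous_id))
      (fun y => by simp only [star_coe, ← coe_mul, norm_coe, star_mul_self, sq]) x

instance [StarModule ℂ F] : StarModule ℂ p.Completion where
  star_smul c x :=
    ext_fun p (f := fun x => star (c • x)) (g := fun x => star c • star x)
      ((continuous_star' p).comp (continuous_const_smul c))
      ((continuous_star' p).const_smul (star c))
      (fun y => by simp only [star_coe, ← coe_smul, star_smul]) x

instance [StarModule ℂ F] : CStarAlgebra p.Completion where

/-- The canonical map of `F` to its completion, as a `*`-homomorphism. -/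
def of : F →⋆ₐ[ℂ] p.Completion where
  toFun := coe p
  map_one' := rfl
  map_mul' := coe_mul p
  map_zero' := rfl
  map_add' := coe_add p
  commutes' c := by
    rw [Algebra.algebraMap_eq_smul_one, Algebra.algebraMap_eq_smul_one, coe_smul]; rfl
  map_star' x := (star_coe p x).symm

variable {p}

theorem norm_of (x : F) : ‖of p x‖ = p x := norm_coe p x

variable {B : Type v} [CStarAlgebra B]

theorem uniformContinuous_of_le (f : F →⋆ₐ[ℂ] B) (hf : ∀ x, ‖f x‖ ≤ p x) :
    UniformContinuous (show p.Space → B from f) :=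
  (AddMonoidHomClass.lipschitz_of_bound (show p.Space →+ B from (f : F →+ B)) 1
    (fun x => by rw [one_mul]; exact hf x)).uniformContinuous

/-- The extension to the completion of a `*`-homomorphism that is contractive for `p`. -/
def lift (f : F →⋆ₐ[ℂ] B) (hf : ∀ x, ‖f x‖ ≤ p x) : p.Completion →⋆ₐ[ℂ] B :=
  let g : p.Completion → B := UniformSpace.Completion.extension (show p.Space → B from f)
  have hg : Continuous g := UniformSpace.Completion.continuous_extension
  have hgc : ∀ x : F, g (coe p x) = f x := fun x =>
    UniformSpace.Completion.extension_coe (α := p.Space) (uniformContinuous_of_le f hf) x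
  { toFun := g
    map_one' := (hgc 1).trans (map_one f)
    map_mul' := fun x y =>
      ext_fun₂ p (f := fun z => g (z.1 * z.2)) (g := fun z => g z.1 * g z.2)
        (hg.comp (continuous_fst.mul continuous_snd))
        ((hg.comp continuous_fst).mul (hg.comp continuous_snd))
        (fun y z => by simp only [← coe_mul, hgc, map_mul]) (x, y)
    map_zero' := (hgc 0).trans (map_zero f)
    map_add' := fun x y =>
      ext_fun₂ p (f := fun z => g (z.1 + z.2)) (g := fun z => g z.1 + g z.2)
        (hg.comp (continuous_fst.add continuous_snd))
        ((hg.comp continuous_fst).add (hg.comp continuous_snd))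
        (fun y z => by simp only [← coe_add, hgc, map_add]) (x, y)
    commutes' := fun c => by
      have h := hgc (algebraMap ℂ F c)
      rw [AlgHomClass.commutes] at h
      rw [← h]
      exact congrArg g ((of p).commutes' c).symm
    map_star' := fun x =>
      ext_fun p (f := fun x => g (star x)) (g := fun x => star (g x))
        (hg.comp (continuous_star' p)) (continuous_star.comp hg)
        (fun y => by simp only [star_coe, hgc, map_star]) x }

theorem lift_of (f : F →⋆ₐ[ℂ] B) (hf : ∀ x, ‖f x‖ ≤ p x) (x : F) : lift f hf (of p x) = f x :=
  UniformSpace.Completion.extension_coe (α := p.Space) (uniformContinuous_of_le f hf) x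

end Completion

end CStarSeminorm

end CStarSeminorm

/-! ### The minimal (spatial) tensor product of C*-algebras -/

section MinTensor

/-- The operator norm in a `*`-representation by bounded operators with adjoints on an inner
product space is a C*-seminorm. -/
def opSeminorm {F : Type u} [Ring F] [StarRing F] [Algebra ℂ F] {E : Type v}
    [NormedAddCommGroup E] [InnerProductSpace ℂ E] (T : F →ₐ[ℂ] (E →L[ℂ] E))
    (hT : ∀ x ξ η, inner ℂ (T (star x) ξ) η = inner ℂ ξ (T x η)) : CStarSeminorm F where
  toFun x := ‖T x‖
  map_zero' := by simp
  add_le' x y := by rw [map_add]; exact norm_add_le _ _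
  neg' x := by rw [map_neg, norm_neg]
  smul' c x := by rw [map_smul, norm_smul]
  mul_le' x y := by rw [map_mul]; exact norm_mul_le _ _
  star_mul_self' x := by
    have key : ∀ y : F, ‖T y‖ ^ 2 ≤ ‖T (star y * y)‖ := by
      intro y
      rw [← Real.le_sqrt (norm_nonneg _) (norm_nonneg _)]
      refine ContinuousLinearMap.opNorm_le_bound _ (Real.sqrt_nonneg _) fun ξ => ?_
      refine le_of_sq_le_sq ?_ (mul_nonneg (Real.sqrt_nonneg _) (norm_nonneg ξ))
      rw [mul_pow, Real.sq_sqrt (norm_nonneg _), ← inner_self_eq_norm_sq (𝕜 := ℂ), ← hT]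
      calc _ ≤ ‖inner ℂ (T (star y) (T y ξ)) ξ‖ := RCLike.re_le_norm _
        _ ≤ ‖T (star y) (T y ξ)‖ * ‖ξ‖ := norm_inner_le_norm _ _
        _ = ‖T (star y * y) ξ‖ * ‖ξ‖ := by
          rw [map_mul]; rfl
        _ ≤ ‖T (star y * y)‖ * ‖ξ‖ * ‖ξ‖ := by
          gcongr; exact ContinuousLinearMap.le_opNorm _ _
        _ = _ := by ring
    have hs : ∀ y : F, ‖T y‖ ≤ ‖T (star y)‖ := by
      intro y
      rcases (norm_nonneg (T y)).eq_or_lt with h | h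
      · rw [← h]; exact norm_nonneg _
      · have h1 := key y
        rw [map_mul, sq] at h1
        exact le_of_mul_le_mul_right (h1.trans (norm_mul_le _ _)) h
    refine le_antisymm ?_ (key x)
    rw [map_mul, sq]
    refine (norm_mul_le _ _).trans ?_
    gcongr
    simpa using hs (star x)

/-- A unital `*`-representation of a C*-algebra on a Hilbert space. -/
structure HilbertRep (A : Type) [CStarAlgebra A] where
  H : Type
  [normed : NormedAddCommGroup H]
  [inner : InnerProductSpace ℂ H]
  [complete : CompleteSpace H]
  π : A →⋆ₐ[ℂ] (H →L[ℂ] H)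

attribute [instance] HilbertRep.normed HilbertRep.inner HilbertRep.complete

variable {A B C D : Type} [CStarAlgebra A] [CStarAlgebra B] [CStarAlgebra C] [CStarAlgebra D]

instance : Nonempty (HilbertRep A) :=
  ⟨{ H := PUnit
     π :=
      { toFun := fun _ => 0
        map_one' := Subsingleton.elim _ _
        map_mul' := fun _ _ => Subsingleton.elim _ _
        map_zero' := Subsingleton.elim _ _
        map_add' := fun _ _ => Subsingleton.elim _ _
        commutes' := fun _ => Subsingleton.elim _ _
        map_star' := fun _ => Subsingleton.elim _ _ } }⟩

/-- The restriction of a representation along a `*`-homomorphism. -/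
def HilbertRep.comp (σ : HilbertRep B) (φ : A →⋆ₐ[ℂ] B) : HilbertRep A where
  H := σ.H
  π := σ.π.comp φ

/-- The representation `a ⊗ b ↦ σ(a) ⊗ τ(b)` of the algebraic tensor product on the (algebraic)
tensor product of the two Hilbert spaces, by bounded operators. -/
def tensorRep (σ : HilbertRep A) (τ : HilbertRep B) :
    A ⊗[ℂ] B →ₐ[ℂ] (σ.H ⊗[ℂ] τ.H →L[ℂ] σ.H ⊗[ℂ] τ.H) :=
  Algebra.TensorProduct.lift
    (AlgHom.ofLinearMap
      { toFun := fun a => (σ.π a).rTensor τ.H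
        map_add' := fun a b => by simp
        map_smul' := fun c a => by simp }
      (by simp) (fun a b => by simp [ContinuousLinearMap.rTensor_mul]))
    (AlgHom.ofLinearMap
      { toFun := fun b => (τ.π b).lTensor σ.H
        map_add' := fun a b => by simp
        map_smul' := fun c a => by simp }
      (by simp) (fun a b => by simp [ContinuousLinearMap.lTensor_mul]))
    (fun a b => by
      show (σ.π a).rTensor τ.H ∘L (τ.π b).lTensor σ.H = (τ.π b).lTensor σ.H ∘L (σ.π a).rTensor τ.H
      simp)

theorem tensorRep_tmul (σ : HilbertRep A) (τ : HilbertRep B) (a : A) (b : B) :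
    tensorRep σ τ (a ⊗ₜ b) = TensorProduct.mapL (σ.π a) (τ.π b) := by
  simp only [tensorRep, Algebra.TensorProduct.lift_tmul]
  rfl

theorem inner_tensorRep_star (σ : HilbertRep A) (τ : HilbertRep B) (x : A ⊗[ℂ] B)
    (ξ η : σ.H ⊗[ℂ] τ.H) :
    inner ℂ (tensorRep σ τ (star x) ξ) η = inner ℂ ξ (tensorRep σ τ x η) := by
  induction x using TensorProduct.induction_on with
  | zero => simp
  | add x y hx hy =>
    simp only [star_add, map_add, add_apply, inner_add_left, inner_add_right,
      hx, hy]
  | tmul a b =>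
    rw [TensorProduct.star_tmul, tensorRep_tmul, tensorRep_tmul, map_star, map_star]
    induction ξ using TensorProduct.induction_on with
    | zero => simp
    | add x y hx hy => simp only [map_add, inner_add_left, hx, hy]
    | tmul h k =>
      induction η using TensorProduct.induction_on with
      | zero => simp
      | add x y hx hy => simp only [map_add, inner_add_right, hx, hy]
      | tmul h' k' =>
        rw [TensorProduct.mapL_tmul, TensorProduct.mapL_tmul, TensorProduct.inner_tmul,
          TensorProduct.inner_tmul, ContinuousLinearMap.star_eq_adjoint,
          ContinuousLinearMap.star_eq_adjoint, ContinuousLinearMap.adjoint_inner_left,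
          ContinuousLinearMap.adjoint_inner_left]

/-- The C*-seminorm `x ↦ ‖(σ ⊗ τ)(x)‖` on the algebraic tensor product. -/
def tensorRepSeminorm (σ : HilbertRep A) (τ : HilbertRep B) : CStarSeminorm (A ⊗[ℂ] B) :=
  opSeminorm (E := σ.H ⊗[ℂ] τ.H) (tensorRep σ τ) (inner_tensorRep_star σ τ)

theorem bddAbove_tensorRepSeminorm (x : A ⊗[ℂ] B) :
    BddAbove (Set.range fun i : HilbertRep A × HilbertRep B => tensorRepSeminorm i.1 i.2 x) := by
  induction x using TensorProduct.induction_on with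
  | zero => exact ⟨0, by rintro _ ⟨i, rfl⟩; simp⟩
  | tmul a b =>
    refine ⟨‖a‖ * ‖b‖, ?_⟩
    rintro _ ⟨i, rfl⟩
    show ‖tensorRep i.1 i.2 (a ⊗ₜ b)‖ ≤ _
    rw [tensorRep_tmul]
    refine (TensorProduct.norm_mapL_le _ _).trans ?_
    gcongr
    · exact NonUnitalStarAlgHom.norm_apply_le i.1.π a
    · exact NonUnitalStarAlgHom.norm_apply_le i.2.π b
  | add x y hx hy =>
    obtain ⟨c, hc⟩ := hx
    obtain ⟨d, hd⟩ := hy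
    refine ⟨c + d, ?_⟩
    rintro _ ⟨i, rfl⟩
    exact (map_add_le_add (tensorRepSeminorm i.1 i.2).toSeminorm x y).trans
      (add_le_add (hc ⟨i, rfl⟩) (hd ⟨i, rfl⟩))

variable (A B) in
/-- The minimal C*-norm on the algebraic tensor product. -/
def minSeminorm : CStarSeminorm (A ⊗[ℂ] B) :=
  CStarSeminorm.iSup (fun i : HilbertRep A × HilbertRep B => tensorRepSeminorm i.1 i.2)
    bddAbove_tensorRepSeminorm

variable (A B) in
/-- The minimal (spatial) C*-tensor product of two C*-algebras. -/
abbrev MinTensor : Type := (minSeminorm A B).Completion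

/-- The elementary tensor `a ⊗ b` in the minimal tensor product. -/
def minTmul (a : A) (b : B) : MinTensor A B :=
  CStarSeminorm.Completion.of (minSeminorm A B) (a ⊗ₜ b)

/-- The algebraic tensor product `a ⊗ b ↦ φ(a) ⊗ ψ(b)` of two `*`-homomorphisms. -/
def algTensorMap (φ : A →⋆ₐ[ℂ] C) (ψ : B →⋆ₐ[ℂ] D) : A ⊗[ℂ] B →⋆ₐ[ℂ] C ⊗[ℂ] D where
  __ := Algebra.TensorProduct.map φ.toAlgHom ψ.toAlgHom
  map_star' x := by
    show Algebra.TensorProduct.map φ.toAlgHom ψ.toAlgHom (star x) =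
      star (Algebra.TensorProduct.map φ.toAlgHom ψ.toAlgHom x)
    induction x using TensorProduct.induction_on with
    | zero => simp
    | tmul a b =>
      rw [TensorProduct.star_tmul, Algebra.TensorProduct.map_tmul, Algebra.TensorProduct.map_tmul,
        TensorProduct.star_tmul]
      congr 1
      · exact map_star φ a
      · exact map_star ψ b
    | add x y hx hy => simp only [star_add, map_add, hx, hy]

theorem tensorRep_algTensorMap (φ : A →⋆ₐ[ℂ] C) (ψ : B →⋆ₐ[ℂ] D) (σ : HilbertRep C)
    (τ : HilbertRep D) (x : A ⊗[ℂ] B) :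
    tensorRep σ τ (algTensorMap φ ψ x) = tensorRep (σ.comp φ) (τ.comp ψ) x := by
  induction x using TensorProduct.induction_on with
  | zero => simp only [map_zero]; rfl
  | tmul a b =>
    rw [tensorRep_tmul]
    exact tensorRep_tmul σ τ (φ a) (ψ b)
  | add x y hx hy => simp only [map_add, hx, hy]; rfl

theorem minSeminorm_algTensorMap_le (φ : A →⋆ₐ[ℂ] C) (ψ : B →⋆ₐ[ℂ] D) (x : A ⊗[ℂ] B) :
    minSeminorm C D (algTensorMap φ ψ x) ≤ minSeminorm A B x := by
  refine ciSup_le fun i => ?_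
  have h : tensorRepSeminorm i.1 i.2 (algTensorMap φ ψ x) =
      tensorRepSeminorm (i.1.comp φ) (i.2.comp ψ) x :=
    congrArg norm (tensorRep_algTensorMap φ ψ i.1 i.2 x)
  rw [h]
  exact le_ciSup (bddAbove_tensorRepSeminorm x) (i.1.comp φ, i.2.comp ψ)

/-- The tensor product `φ ⊗ ψ` of two `*`-homomorphisms, on the minimal tensor products. -/
def minTensorMap (φ : A →⋆ₐ[ℂ] C) (ψ : B →⋆ₐ[ℂ] D) : MinTensor A B →⋆ₐ[ℂ] MinTensor C D :=
  CStarSeminorm.Completion.lift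
    ((CStarSeminorm.Completion.of (minSeminorm C D)).comp (algTensorMap φ ψ))
    (fun x => (CStarSeminorm.Completion.norm_of (p := minSeminorm C D) _).le.trans
      (minSeminorm_algTensorMap_le φ ψ x))

end MinTensor

/-! ### Universal unital C*-algebras given by generators and relations -/

section Universal

/-- The free unital complex `*`-algebra on a set `X`: the free algebra on the letters `x` and `x*`,
`x ∈ X`. -/
def FreeStarAlgebra (X : Type u) : Type u := FreeAlgebra ℂ (X ⊕ X)

namespace FreeStarAlgebra

variable {X : Type u}

instance : Ring (FreeStarAlgebra X) := inferInstanceAs (Ring (FreeAlgebra ℂ (X ⊕ X)))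
instance : Algebra ℂ (FreeStarAlgebra X) := inferInstanceAs (Algebra ℂ (FreeAlgebra ℂ (X ⊕ X)))

/-- The letter `x` or `x*`. -/
def letter (s : X ⊕ X) : FreeStarAlgebra X := FreeAlgebra.ι ℂ s

/-- The generator `x`. -/
def gen (x : X) : FreeStarAlgebra X := letter (Sum.inl x)

/-- The algebra homomorphisms out of the free algebra on the letters. -/
def liftAlg {B : Type v} [Ring B] [Algebra ℂ B] (f : X ⊕ X → B) : FreeStarAlgebra X →ₐ[ℂ] B :=
  FreeAlgebra.lift ℂ f

theorem liftAlg_letter {B : Type v} [Ring B] [Algebra ℂ B] (f : X ⊕ X → B) (s : X ⊕ X) :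
    liftAlg f (letter s) = f s :=
  FreeAlgebra.lift_ι_apply f s

theorem induction {P : FreeStarAlgebra X → Prop} (h_map : ∀ c : ℂ, P (algebraMap ℂ _ c))
    (h_letter : ∀ s, P (letter s)) (h_mul : ∀ a b, P a → P b → P (a * b))
    (h_add : ∀ a b, P a → P b → P (a + b)) (a : FreeStarAlgebra X) : P a :=
  FreeAlgebra.induction ℂ (X ⊕ X) (motive := P) h_map h_letter h_mul h_add a

/-- The opposite of the free algebra, with complex numbers acting through their conjugates. -/
def ConjOp (X : Type u) : Type u := (FreeStarAlgebra X)ᵐᵒᵖ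

instance : Ring (ConjOp X) := inferInstanceAs (Ring (FreeStarAlgebra X)ᵐᵒᵖ)
instance : Algebra ℂ (ConjOp X) :=
  RingHom.toAlgebra'
    ((algebraMap ℂ (FreeStarAlgebra X)ᵐᵒᵖ).comp (starRingEnd ℂ))
    (fun c x => Algebra.commutes (A := (FreeStarAlgebra X)ᵐᵒᵖ) (starRingEnd ℂ c) x)

/-- The conjugate-linear anti-homomorphism that exchanges the letters `x` and `x*`. -/
def starHom : FreeStarAlgebra X →ₐ[ℂ] ConjOp X :=
  liftAlg fun s => (MulOpposite.op (letter s.swap) : (FreeStarAlgebra X)ᵐᵒᵖ)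

instance : Star (FreeStarAlgebra X) :=
  ⟨fun a => MulOpposite.unop (show (FreeStarAlgebra X)ᵐᵒᵖ from starHom a)⟩

theorem star_letter (s : X ⊕ X) : star (letter s : FreeStarAlgebra X) = letter s.swap := by
  have h : starHom (letter s : FreeStarAlgebra X) =
      (MulOpposite.op (letter s.swap) : (FreeStarAlgebra X)ᵐᵒᵖ) := liftAlg_letter _ s
  exact congrArg (fun z : (FreeStarAlgebra X)ᵐᵒᵖ => MulOpposite.unop z) h

theorem star_add' (a b : FreeStarAlgebra X) : star (a + b) = star a + star b :=
  congrArg (fun z : (FreeStarAlgebra X)ᵐᵒᵖ => MulOpposite.unop z) (map_add starHom a b)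

theorem star_mul' (a b : FreeStarAlgebra X) : star (a * b) = star b * star a :=
  congrArg (fun z : (FreeStarAlgebra X)ᵐᵒᵖ => MulOpposite.unop z) (map_mul starHom a b)

theorem star_algebraMap (c : ℂ) :
    star (algebraMap ℂ (FreeStarAlgebra X) c) = algebraMap ℂ (FreeStarAlgebra X) (conj c) :=
  congrArg (fun z : (FreeStarAlgebra X)ᵐᵒᵖ => MulOpposite.unop z) (AlgHom.commutes starHom c)

instance : StarRing (FreeStarAlgebra X) where
  star_involutive a := by
    induction a using induction with
    | h_map c => rw [star_algebraMap, star_algebraMap, Complex.conj_conj]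
    | h_letter s => rw [star_letter, star_letter, Sum.swap_swap]
    | h_mul a b ha hb => rw [star_mul', star_mul', ha, hb]
    | h_add a b ha hb => rw [star_add', star_add', ha, hb]
  star_mul := star_mul'
  star_add := star_add'

instance : StarModule ℂ (FreeStarAlgebra X) where
  star_smul c a := by
    rw [Algebra.smul_def, star_mul', star_algebraMap, Algebra.smul_def, Algebra.commutes]
    rfl

/-- The `*`-homomorphism out of the free `*`-algebra with prescribed values at the generators. -/
def lift {B : Type v} [Ring B] [StarRing B] [Algebra ℂ B] [StarModule ℂ B] (f : X → B) :
    FreeStarAlgebra X →⋆ₐ[ℂ] B where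
  __ := liftAlg (Sum.elim f fun x => star (f x))
  map_star' a := by
    show liftAlg (Sum.elim f fun x => star (f x)) (star a) =
      star (liftAlg (Sum.elim f fun x => star (f x)) a)
    induction a using induction with
    | h_map c => rw [star_algebraMap, AlgHom.commutes, AlgHom.commutes]; exact algebraMap_star_comm c
    | h_letter s =>
      rw [star_letter, liftAlg_letter, liftAlg_letter]
      cases s <;> simp
    | h_mul a b ha hb => rw [star_mul, map_mul, map_mul, star_mul, ha, hb]
    | h_add a b ha hb => rw [star_add, map_add, map_add, star_add, ha, hb]

theorem lift_gen {B : Type v} [Ring B] [StarRing B] [Algebra ℂ B] [StarModule ℂ B] (f : X → B)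
    (x : X) : lift f (gen x) = f x :=
  liftAlg_letter _ _

end FreeStarAlgebra

variable {X : Type u}

/-- The C*-seminorms on the free `*`-algebra for which the relations `r = 0`, `r ∈ R`, hold. -/
def Admissible (R : Set (FreeStarAlgebra X)) : Type u :=
  {p : CStarSeminorm (FreeStarAlgebra X) // ∀ r ∈ R, p r = 0}

instance (R : Set (FreeStarAlgebra X)) : Nonempty (Admissible R) :=
  ⟨⟨CStarSeminorm.zero, fun _ _ => rfl⟩⟩

/-- The relations `R` bound the norms of the generators. -/
def BoundsGenerators (R : Set (FreeStarAlgebra X)) : Prop :=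
  ∀ x : X, ∃ M : ℝ, ∀ p : Admissible R, p.1 (FreeStarAlgebra.gen x) ≤ M

theorem bddAbove_admissible {R : Set (FreeStarAlgebra X)} (hR : BoundsGenerators R)
    (a : FreeStarAlgebra X) : BddAbove (Set.range fun p : Admissible R => p.1 a) := by
  suffices h : ∃ M : ℝ, 0 ≤ M ∧ ∀ p : Admissible R, p.1 a ≤ M by
    obtain ⟨M, -, h⟩ := h
    exact ⟨M, by rintro _ ⟨p, rfl⟩; exact h p⟩
  induction a using FreeStarAlgebra.induction with
  | h_map c =>
    refine ⟨‖c‖, norm_nonneg c, fun p => ?_⟩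
    rw [Algebra.algebraMap_eq_smul_one, map_smul_eq_mul]
    exact mul_le_of_le_one_right (norm_nonneg c) p.1.one_le
  | h_letter s =>
    obtain ⟨M, hM⟩ := hR (Sum.elim id id s)
    refine ⟨M, (CStarSeminorm.nonneg _ _).trans (hM (Classical.arbitrary _)), fun p => ?_⟩
    refine le_trans (le_of_eq ?_) (hM p)
    cases s with
    | inl x => rfl
    | inr x =>
      rw [← p.1.star_eq, FreeStarAlgebra.star_letter]
      rfl
  | h_mul a b ha hb =>
    obtain ⟨M, hM0, hM⟩ := ha
    obtain ⟨N, hN0, hN⟩ := hb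
    exact ⟨M * N, mul_nonneg hM0 hN0, fun p => (p.1.mul_le a b).trans
      (mul_le_mul (hM p) (hN p) (p.1.nonneg b) hM0)⟩
  | h_add a b ha hb =>
    obtain ⟨M, hM0, hM⟩ := ha
    obtain ⟨N, hN0, hN⟩ := hb
    exact ⟨M + N, add_nonneg hM0 hN0, fun p => (map_add_le_add p.1.toSeminorm a b).trans
      (add_le_add (hM p) (hN p))⟩

/-- The largest C*-seminorm on the free `*`-algebra for which the relations hold. -/
def universalSeminorm (R : Set (FreeStarAlgebra X)) (hR : BoundsGenerators R) :
    CStarSeminorm (FreeStarAlgebra X) :=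
  CStarSeminorm.iSup (fun p : Admissible R => p.1) (bddAbove_admissible hR)

/-- The universal unital C*-algebra with generators `X` and relations `r = 0`, `r ∈ R`. -/
abbrev UniversalCStar (R : Set (FreeStarAlgebra X)) (hR : BoundsGenerators R) : Type u :=
  (universalSeminorm R hR).Completion

namespace UniversalCStar

variable (R : Set (FreeStarAlgebra X)) (hR : BoundsGenerators R)

/-- The generator `x` of the universal C*-algebra. -/
def gen (x : X) : UniversalCStar R hR :=
  CStarSeminorm.Completion.of (universalSeminorm R hR) (FreeStarAlgebra.gen x)

/-- The generators satisfy the relations. -/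
theorem relation {r : FreeStarAlgebra X} (hr : r ∈ R) :
    FreeStarAlgebra.lift (gen R hR) r = 0 := by
  have h : ∀ a : FreeStarAlgebra X, FreeStarAlgebra.lift (gen R hR) a =
      CStarSeminorm.Completion.of (universalSeminorm R hR) a := by
    intro a
    induction a using FreeStarAlgebra.induction with
    | h_map c => rw [AlgHomClass.commutes, AlgHomClass.commutes]
    | h_letter s =>
      cases s with
      | inl x => exact FreeStarAlgebra.lift_gen _ x
      | inr x =>
        have h : (FreeStarAlgebra.letter (Sum.inr x) : FreeStarAlgebra X) =
            star (FreeStarAlgebra.gen x) := (FreeStarAlgebra.star_letter (Sum.inl x)).symm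
        rw [h, map_star, map_star, FreeStarAlgebra.lift_gen]
        rfl
    | h_mul a b ha hb => rw [map_mul, map_mul, ha, hb]
    | h_add a b ha hb => rw [map_add, map_add, ha, hb]
  rw [h, ← norm_eq_zero, CStarSeminorm.Completion.norm_of]
  exact le_antisymm (ciSup_le fun p => (p.2 r hr).le) (CStarSeminorm.nonneg _ _)

variable {R} {B : Type v} [CStarAlgebra B]

/-- The universal property: elements of a C*-algebra that satisfy the relations are the images of
the generators under a `*`-homomorphism. -/
def lift (f : X → B) (hf : ∀ r ∈ R, FreeStarAlgebra.lift f r = 0) :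
    UniversalCStar R hR →⋆ₐ[ℂ] B :=
  CStarSeminorm.Completion.lift (FreeStarAlgebra.lift f) fun a =>
    le_ciSup (bddAbove_admissible hR a)
      (⟨{ toFun := fun a => ‖FreeStarAlgebra.lift f a‖
          map_zero' := by simp
          add_le' := fun x y => by rw [map_add]; exact norm_add_le _ _
          neg' := fun x => by rw [map_neg, norm_neg]
          smul' := fun c x => by rw [map_smul, norm_smul]
          mul_le' := fun x y => by rw [map_mul]; exact norm_mul_le _ _
          star_mul_self' := fun x => by
            rw [map_mul, map_star, CStarRing.norm_star_mul_self, sq] },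
        fun r hr => by
          show ‖FreeStarAlgebra.lift f r‖ = 0
          rw [hf r hr, norm_zero]⟩ : Admissible R)

theorem lift_gen (f : X → B) (hf : ∀ r ∈ R, FreeStarAlgebra.lift f r = 0) (x : X) :
    lift hR f hf (gen R hR x) = f x :=
  (CStarSeminorm.Completion.lift_of _ _ _).trans (FreeStarAlgebra.lift_gen f x)

end UniversalCStar

/-- If `∑ xₛ* xₛ = 1` with respect to a C*-seminorm, then the `xₛ` are contractions. -/
theorem CStarSeminorm.le_one_of_sum {F : Type u} [Ring F] [StarRing F] [Algebra ℂ F]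
    [StarModule ℂ F] (p : CStarSeminorm F) {ι : Type v} [Fintype ι] (x : ι → F)
    (h : p (∑ s, star (x s) * x s - 1) = 0) (s : ι) : p (x s) ≤ 1 := by
  let _ : PartialOrder p.Completion := CStarAlgebra.spectralOrder _
  have _ : StarOrderedRing p.Completion := CStarAlgebra.spectralOrderedRing _
  have h1 : ∑ t, star (Completion.of p (x t)) * Completion.of p (x t) = 1 := by
    rw [← Completion.norm_of, norm_eq_zero, map_sub, map_sum, map_one, sub_eq_zero] at h
    rw [← h]
    exact Finset.sum_congr rfl fun t _ => by rw [map_mul, map_star]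
  have h2 : star (Completion.of p (x s)) * Completion.of p (x s) ≤ 1 := by
    rw [← h1]
    exact Finset.single_le_sum
      (f := fun t => star (Completion.of p (x t)) * Completion.of p (x t))
      (fun t _ => star_mul_self_nonneg _) (Finset.mem_univ s)
  have h3 := CStarAlgebra.norm_le_norm_of_nonneg_of_le (star_mul_self_nonneg _) h2
  have h4 : ‖(1 : p.Completion)‖ ≤ 1 := by
    rw [← map_one (Completion.of p), Completion.norm_of]
    exact p.one_le
  rw [CStarRing.norm_star_mul_self, Completion.norm_of] at h3
  nlinarith [p.nonneg (x s)]

end Universal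

/-! ### Compact matrix quantum groups -/

section QuantumGroups

/-- A pair `(A, u)` of a unital C*-algebra and a square matrix with entries in it. -/
structure MatrixPair where
  n : ℕ
  A : Type
  [cstar : CStarAlgebra A]
  u : Matrix (Fin n) (Fin n) A

attribute [instance] MatrixPair.cstar

/-- `Δ` is the comultiplication of `(A, u)`: a unital `*`-homomorphism `A → A ⊗ A` with
`Δ(u_ij) = ∑ₖ u_ik ⊗ u_kj`. -/
def IsComultiplication (G : MatrixPair) (Δ : G.A →⋆ₐ[ℂ] MinTensor G.A G.A) : Prop :=
  ∀ i j, Δ (G.u i j) = ∑ k, minTmul (G.u i k) (G.u k j)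

/-- Isomorphism of compact quantum groups: an isomorphism of the C*-algebras that intertwines the
comultiplications. -/
def Isomorphic (G K : MatrixPair) : Prop :=
  ∃ (ΔG : G.A →⋆ₐ[ℂ] MinTensor G.A G.A) (ΔK : K.A →⋆ₐ[ℂ] MinTensor K.A K.A) (Φ : G.A ≃⋆ₐ[ℂ] K.A),
    IsComultiplication G ΔG ∧ IsComultiplication K ΔK ∧
      ∀ x, ΔK (Φ x) = minTensorMap (Φ : G.A →⋆ₐ[ℂ] K.A) (Φ : G.A →⋆ₐ[ℂ] K.A) (ΔG x)

/-! #### The Woronowicz construction in dimension three; the indices `1, 2, 3` are `0, 1, 2` -/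

/-- The array `E` is nonzero exactly at the permutations of the three indices. -/
def PermutationCondition (E : Fin 3 → Fin 3 → Fin 3 → ℂ) : Prop :=
  ∀ i j k, E i j k ≠ 0 ↔ Function.Bijective ![i, j, k]

/-- The characteristic constant `co(l,n) = (E_jln / E_jnl) (E_nlj / E_lnj)` for `l ≠ n`, where
`j` is the third index: as `0 + 1 + 2 = 0` in `Fin 3`, it is `-(l + n)`. -/
def charConst (E : Fin 3 → Fin 3 → Fin 3 → ℂ) (l n : Fin 3) : ℂ :=
  let j : Fin 3 := -(l + n)
  E j l n / E j n l * (E n l j / E l n j)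

/-- The unitarity relations and the twisted determinant relations for the matrix of generators. -/
def woronowiczRelations (E : Fin 3 → Fin 3 → Fin 3 → ℂ) :
    Set (FreeStarAlgebra (Fin 3 × Fin 3)) :=
  let u : Fin 3 → Fin 3 → FreeStarAlgebra (Fin 3 × Fin 3) := fun j k => FreeStarAlgebra.gen (j, k)
  {r | ∃ j k, r = ∑ s, u j s * star (u k s) - (if j = k then 1 else 0)} ∪
  {r | ∃ j k, r = ∑ s, star (u s j) * u s k - (if j = k then 1 else 0)} ∪
  {r | ∃ a b c, r = ∑ i, ∑ j, ∑ k, E i j k • (u a i * u b j * u c k) - E a b c • 1}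

theorem boundsGenerators_woronowiczRelations (E : Fin 3 → Fin 3 → Fin 3 → ℂ) :
    BoundsGenerators (woronowiczRelations E) := fun x =>
  ⟨1, fun p => p.1.le_one_of_sum (fun s : Fin 3 => FreeStarAlgebra.gen (s, x.2))
    (p.2 _ (Or.inl (Or.inr ⟨x.2, x.2, by simp⟩))) x.1⟩

/-- The C*-algebra of the Woronowicz construction: the universal one for these relations. -/
abbrev WoronowiczAlgebra (E : Fin 3 → Fin 3 → Fin 3 → ℂ) : Type :=
  UniversalCStar (woronowiczRelations E) (boundsGenerators_woronowiczRelations E)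

/-- The quantum group related to the array `E` through the Woronowicz construction. It is a
PW-quantum group if `E` satisfies the permutation condition. -/
abbrev woronowicz (E : Fin 3 → Fin 3 → Fin 3 → ℂ) : MatrixPair where
  n := 3
  A := WoronowiczAlgebra E
  u := Matrix.of fun j k => UniversalCStar.gen _ _ (j, k)

/-! #### The quantum group `U_q(2)` -/

/-- The names of the generators of `C(U_q(2))`. -/
inductive UqGen : Type
  | a
  | c
  | v

/-- The defining relations of `C(U_q(2))`; with `q = |q| e^{it}`, the last one is
`c v = e^{-2it} v c`. -/
def uqRelations (q : ℂ) : Set (FreeStarAlgebra UqGen) :=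
  let a : FreeStarAlgebra UqGen := FreeStarAlgebra.gen UqGen.a
  let c : FreeStarAlgebra UqGen := FreeStarAlgebra.gen UqGen.c
  let v : FreeStarAlgebra UqGen := FreeStarAlgebra.gen UqGen.v
  {a * c - conj q • (c * a),
   a * star c - q • (star c * a),
   star a * a + star c * c - 1,
   a * star a + ((‖q‖ : ℂ) ^ 2) • (star c * c) - 1,
   c * star c - star c * c,
   v * star v - 1,
   star v * v - 1,
   a * v - v * a,
   c * v - Complex.exp (-2 * Complex.I * (Complex.arg q : ℂ)) • (v * c)}

theorem boundsGenerators_uqRelations (q : ℂ) : BoundsGenerators (uqRelations q) := by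
  intro x
  refine ⟨1, fun p => ?_⟩
  have h1 := p.1.le_one_of_sum
    ![FreeStarAlgebra.gen UqGen.a, FreeStarAlgebra.gen UqGen.c]
    (p.2 _ (by simp [uqRelations, Fin.sum_univ_two]))
  have h2 := p.1.le_one_of_sum ![FreeStarAlgebra.gen UqGen.v]
    (p.2 _ (by simp [uqRelations]))
  cases x with
  | a => exact h1 0
  | c => exact h1 1
  | v => exact h2 0

/-- The C*-algebra `C(U_q(2))`. -/
abbrev UqAlgebra (q : ℂ) : Type := UniversalCStar (uqRelations q) (boundsGenerators_uqRelations q)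

/-- The fundamental corepresentation `v ⊕ [[a, -q c* v*], [c, a* v*]]` of `U_q(2)`. -/
def uqMatrix (q : ℂ) : Matrix (Fin 3) (Fin 3) (UqAlgebra q) :=
  let a : UqAlgebra q := UniversalCStar.gen _ _ UqGen.a
  let c : UqAlgebra q := UniversalCStar.gen _ _ UqGen.c
  let v : UqAlgebra q := UniversalCStar.gen _ _ UqGen.v
  !![v, 0, 0;
     0, a, -(q • (star c * star v));
     0, c, star a * star v]

/-- The quantum group `U_q(2)`. -/
abbrev Uq2 (q : ℂ) : MatrixPair where
  n := 3
  A := UqAlgebra q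
  u := uqMatrix q

/-! #### The quantum version of the two-dimensional torus -/

/-- `C(𝕋²)` with the coefficients of `𝕋² ⊂ GL(2)`, the group of diagonal matrices
`diag(z₁, z₂)` with `|z₁| = |z₂| = 1`. -/
abbrev torus2 : MatrixPair where
  n := 2
  A := C(Circle × Circle, ℂ)
  u := Matrix.diagonal
    ![⟨fun z => (z.1 : ℂ), by fun_prop⟩, ⟨fun z => (z.2 : ℂ), by fun_prop⟩]

end QuantumGroups

end PWQuantum

end

noncomputable section

namespace PWQuantum

/-! ### Twisted unitary matrices over a `*`-algebra -/

/-! ### Linear systems with coefficients in a noncommutative ring -/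

section LinearSystems

/-! Number the indices from 0 and let `m_j` be the product of the two entries of `E` with middle
index `j`. Then `co(l,n) = m_l / m_n`, so the hypotheses say `m_1 = m_2 ≠ m_0`.

Unitarity makes the cubic determinant relations quadratic: multiplication by `u*` cancels the first
factor (`quadratic`). Cancelling the last factor requires an inverse of the transpose of `u`. The
determinant relations supply one, a matrix `V` of quadratic polynomials in the entries
(`transposeInv`, `sum_transposeInv_mul`). Hence every quadratic relation has a left and a right
version (`quadratic`, `quadratic_last`, and their conjugate analogues). Compared at equal indices,
the two versions form a 2×2 system of determinant `±(m_0 - m_1)`, up to conjugation, and force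
products such as `u_a0 u_a1` to vanish. A further elimination shows that `u_10` annihilates `u_00*`,
`u_01*`, `u_02*`. Since `∑ u_0k* V_0k* = 1`, it follows that `u_10 = 0` (`apply_one_zero`), and by
symmetry `u_20 = 0`. Thus `u` is the direct sum of a unitary `v = u_00` and a 2×2 block.

Put `q = -E_210 / E_120`, `a = u_11`, `c = u_21`. The remaining relations always imply those of
`U_q(2)` (`isUqTriple`). They also evaluate `v u_12` twice, as `-q̄ c*` and as `(E_201 / E_102) c*`.
If `E_201 = -q̄ E_102`, the corepresentation of `U_q(2)` in turn satisfies the relations for `E`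
(`IsUqTriple.isTwistedUnitary`), and the two universal properties give inverse isomorphisms.
Otherwise `c = 0`: the algebra is generated by commuting unitaries `a` and `v`, subject to no
further relation, and Gelfand duality with Stone–Weierstrass identifies it with `C(𝕋²)`. -/

theorem eq_sum_of_left_inverse {B : Type*} [Ring B] {V U : Fin 3 → Fin 3 → B}
    (h : ∀ p i, ∑ a, V p a * U a i = if p = i then 1 else 0) {F G : Fin 3 → B}
    (hF : ∀ a, ∑ i, U a i * F i = G a) (p : Fin 3) : F p = ∑ a, V p a * G a := by
  simp_rw [← hF, Finset.mul_sum]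
  rw [Finset.sum_comm]
  simp_rw [← mul_assoc, ← Finset.sum_mul, h]
  simp

theorem eq_sum_of_right_inverse {B : Type*} [Ring B] {V U : Fin 3 → Fin 3 → B}
    (h : ∀ i p, ∑ a, U i a * V a p = if i = p then 1 else 0) {F G : Fin 3 → B}
    (hF : ∀ a, ∑ i, F i * U i a = G a) (p : Fin 3) : F p = ∑ a, G a * V a p := by
  simp_rw [← hF, Finset.sum_mul]
  rw [Finset.sum_comm]
  simp_rw [mul_assoc, ← Finset.mul_sum, h]
  simp

theorem sum_comm_three {ι M : Type*} [Fintype ι] [AddCommMonoid M] (f : ι → ι → ι → ι → M) :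
    ∑ i, ∑ x, ∑ y, ∑ z, f i x y z = ∑ x, ∑ y, ∑ z, ∑ i, f i x y z := by
  rw [Finset.sum_comm]
  refine Finset.sum_congr rfl fun x _ => ?_
  rw [Finset.sum_comm]
  exact Finset.sum_congr rfl fun y _ => Finset.sum_comm

theorem sum_comm_six {ι M : Type*} [Fintype ι] [AddCommMonoid M]
    (f : ι → ι → ι → ι → ι → ι → M) :
    ∑ i, ∑ j, ∑ k, ∑ x, ∑ y, ∑ z, f i j k x y z = ∑ x, ∑ y, ∑ z, ∑ i, ∑ j, ∑ k, f i j k x y z :=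
  calc _ = ∑ i, ∑ j, ∑ x, ∑ y, ∑ z, ∑ k, f i j k x y z :=
        Finset.sum_congr rfl fun _ _ => Finset.sum_congr rfl fun _ _ => sum_comm_three _
    _ = ∑ i, ∑ x, ∑ y, ∑ z, ∑ j, ∑ k, f i j k x y z :=
        Finset.sum_congr rfl fun i _ => sum_comm_three fun j x y z => ∑ k, f i j k x y z
    _ = _ := sum_comm_three fun i x y z => ∑ j, ∑ k, f i j k x y z

/-- Cramer's rule: the coefficients are scalars, so the unknowns may live in any module. -/
theorem eq_zero_of_smul_add_smul {M : Type*} [AddCommGroup M] [Module ℂ M] {α β γ δ : ℂ} {x y : M}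
    (h₁ : α • x + β • y = 0) (h₂ : γ • x + δ • y = 0) (hdet : α * δ - β * γ ≠ 0) :
    x = 0 ∧ y = 0 := by
  constructor
  · refine (smul_eq_zero.1 ?_).resolve_left hdet
    calc (α * δ - β * γ) • x = δ • (α • x + β • y) - β • (γ • x + δ • y) := by module
      _ = 0 := by rw [h₁, h₂]; simp
  · refine (smul_eq_zero.1 ?_).resolve_left hdet
    calc (α * δ - β * γ) • y = α • (γ • x + δ • y) - γ • (α • x + β • y) := by module
      _ = 0 := by rw [h₁, h₂]; simp

end LinearSystems

section TwistedUnitary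

variable {B : Type*} [Ring B] [StarRing B] [Algebra ℂ B]

/-- The matrix `u` is unitary and satisfies the twisted determinant relations for `E`. -/
structure IsTwistedUnitary (E : Fin 3 → Fin 3 → Fin 3 → ℂ) (u : Fin 3 → Fin 3 → B) : Prop where
  row : ∀ j k, ∑ s, u j s * star (u k s) = if j = k then 1 else 0
  col : ∀ j k, ∑ s, star (u s j) * u s k = if j = k then 1 else 0
  det : ∀ a b c, ∑ i, ∑ j, ∑ k, E i j k • (u a i * u b j * u c k) = E a b c • 1

/-- For a unitary matrix the determinant relations follow from quadratic relations. -/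
theorem IsTwistedUnitary.of_quadratic {E : Fin 3 → Fin 3 → Fin 3 → ℂ} {u : Fin 3 → Fin 3 → B}
    (row : ∀ j k, ∑ s, u j s * star (u k s) = if j = k then 1 else 0)
    (col : ∀ j k, ∑ s, star (u s j) * u s k = if j = k then 1 else 0)
    (quad : ∀ p b c, ∑ j, ∑ k, E p j k • (u b j * u c k) = ∑ a, E a b c • star (u a p)) :
    IsTwistedUnitary E u where
  row := row
  col := col
  det a b c := by
    -- After left multiplication by `u a i`, summation over `i` produces the entry `(a, d)` of `u
    -- u*`, so only `d = a` survives.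
    have h : ∀ i, ∑ j, ∑ k, E i j k • (u a i * u b j * u c k) =
        ∑ d, E d b c • (u a i * star (u d i)) := fun i => by
      have := congrArg (u a i * ·) (quad i b c)
      simpa only [Finset.mul_sum, mul_smul_comm, mul_assoc] using this
    simp_rw [h]
    rw [Finset.sum_comm]
    simp_rw [← Finset.smul_sum, row]
    simp

theorem IsTwistedUnitary.map {C : Type*} [Ring C] [StarRing C] [Algebra ℂ C] (φ : B →⋆ₐ[ℂ] C)
    {E : Fin 3 → Fin 3 → Fin 3 → ℂ} {u : Fin 3 → Fin 3 → B} (h : IsTwistedUnitary E u) :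
    IsTwistedUnitary E fun i j => φ (u i j) where
  row j k := by simpa [apply_ite φ, map_star] using congrArg φ (h.row j k)
  col j k := by simpa [apply_ite φ, map_star] using congrArg φ (h.col j k)
  det a b c := by simpa using congrArg φ (h.det a b c)

/-- The product of two twisted unitary matrices whose entries commute with each other. -/
theorem IsTwistedUnitary.mul {E : Fin 3 → Fin 3 → Fin 3 → ℂ} {v w : Fin 3 → Fin 3 → B}
    (hv : IsTwistedUnitary E v) (hw : IsTwistedUnitary E w)
    (comm : ∀ i j k l, v i j * w k l = w k l * v i j) :
    IsTwistedUnitary E fun i j => ∑ k, v i k * w k j where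
  row j k := by
    have h : ∀ s, (∑ x, v j x * w x s) * star (∑ y, v k y * w y s) =
        ∑ x, ∑ y, v j x * (w x s * star (w y s)) * star (v k y) := fun s => by
      simp_rw [star_sum, Finset.sum_mul_sum, star_mul, mul_assoc]
    simp_rw [h]
    rw [Finset.sum_comm]
    simp_rw [Finset.sum_comm (s := Finset.univ (α := Fin 3)) (f := fun s y =>
      v j _ * (w _ s * star (w y s)) * star (v k y)), ← Finset.sum_mul, ← Finset.mul_sum, hw.row]
    simpa using hv.row j k
  col j k := by
    have h : ∀ s, star (∑ x, v s x * w x j) * (∑ y, v s y * w y k) =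
        ∑ x, ∑ y, star (w x j) * (star (v s x) * v s y) * w y k := fun s => by
      simp_rw [star_sum, Finset.sum_mul_sum, star_mul, mul_assoc]
    simp_rw [h]
    rw [Finset.sum_comm]
    simp_rw [Finset.sum_comm (s := Finset.univ (α := Fin 3)) (f := fun s y =>
      star (w _ j) * (star (v s _) * v s y) * w y k), ← Finset.sum_mul, ← Finset.mul_sum, hv.col]
    simpa using hw.col j k
  det a b c := by
    have h : ∀ i j k, E i j k • ((∑ x, v a x * w x i) * (∑ y, v b y * w y j) *
        (∑ z, v c z * w z k)) = ∑ x, ∑ y, ∑ z, v a x * v b y * v c z *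
          (E i j k • (w x i * w y j * w z k)) := fun i j k => by
      simp_rw [Finset.sum_mul_sum, Finset.sum_mul, Finset.smul_sum]
      refine Finset.sum_congr rfl fun x _ => ?_
      rw [Finset.sum_comm]
      refine Finset.sum_congr rfl fun y _ => Finset.sum_congr rfl fun z _ => ?_
      rw [mul_smul_comm]
      congr 1
      -- The entries of `v` move to the left of those of `w`, and the order within each family is
      -- kept. The determinant relation for `w` can then be applied first, and the one for `v` after
      -- it.
      calc v a x * w x i * (v b y * w y j) * (v c z * w z k)
          = v a x * (w x i * v b y) * (w y j * v c z) * w z k := by noncomm_ring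
        _ = v a x * v b y * (w x i * v c z) * w y j * w z k := by
          rw [← comm, ← comm]; noncomm_ring
        _ = v a x * v b y * v c z * (w x i * w y j * w z k) := by
          rw [← comm]; noncomm_ring
    have h' : ∑ i, ∑ j, ∑ k, E i j k • ((∑ x, v a x * w x i) * (∑ y, v b y * w y j) *
        (∑ z, v c z * w z k)) = ∑ x, ∑ y, ∑ z, v a x * v b y * v c z *
          ∑ i, ∑ j, ∑ k, E i j k • (w x i * w y j * w z k) := by
      simp_rw [h, Finset.mul_sum]
      exact sum_comm_six _
    rw [h']
    simp_rw [hw.det, mul_smul_comm, mul_one]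
    exact hv.det a b c

variable {E : Fin 3 → Fin 3 → Fin 3 → ℂ} {u : Fin 3 → Fin 3 → B}

/-! ### Relations obtained by cancelling one factor with the adjoint -/

namespace IsTwistedUnitary

theorem quadratic (h : IsTwistedUnitary E u) (p b c : Fin 3) :
    ∑ j, ∑ k, E p j k • (u b j * u c k) = ∑ a, E a b c • star (u a p) := by
  have := eq_sum_of_left_inverse h.col (F := fun i => ∑ j, ∑ k, E i j k • (u b j * u c k))
    (G := fun a => E a b c • 1) (fun a => by
      simp_rw [← h.det a b c, Finset.mul_sum, mul_smul_comm, mul_assoc]) p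
  simpa using this

/-- The adjoint of `quadratic` contains one adjoint factor on the right; right multiplication by `u`
removes it because `u* u = 1`. -/
theorem quadratic_star [StarModule ℂ B] (h : IsTwistedUnitary E u) (d i j : Fin 3) :
    ∑ a, ∑ b, conj (E a b d) • (u a i * u b j) = ∑ k, conj (E i j k) • star (u d k) := by
  have := eq_sum_of_right_inverse (U := fun j b => star (u b j)) (V := u) h.col
    (F := fun j => ∑ k, conj (E i j k) • star (u d k))
    (G := fun b => ∑ a, conj (E a b d) • u a i) (fun b => by
      have := congrArg star (h.quadratic i b d)
      simp only [star_sum, star_smul, star_mul, star_star] at this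
      simp_rw [Finset.sum_mul, smul_mul_assoc]
      exact this) j
  rw [this, Finset.sum_comm]
  simp_rw [Finset.sum_mul, smul_mul_assoc]

/-- One more multiplication of `quadratic_star` by `u`. The transpose of `u` thus obeys determinant
relations for the conjugate array, and these make it invertible. -/
theorem det_star [StarModule ℂ B] (h : IsTwistedUnitary E u) (i j k : Fin 3) :
    ∑ a, ∑ b, ∑ c, conj (E a b c) • (u a i * u b j * u c k) = conj (E i j k) • (1 : B) := by
  have h' : ∑ c, (∑ a, ∑ b, conj (E a b c) • (u a i * u b j)) * u c k =
      conj (E i j k) • (1 : B) := by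
    simp_rw [h.quadratic_star, Finset.sum_mul]
    rw [Finset.sum_comm]
    simp_rw [smul_mul_assoc, ← Finset.smul_sum, h.col]
    simp
  rw [← h']
  simp only [Finset.sum_mul, smul_mul_assoc]
  simp only [Fin.sum_univ_three]
  abel

end IsTwistedUnitary

/-- The candidate for the inverse of the transposed matrix. -/
def transposeInv (E : Fin 3 → Fin 3 → Fin 3 → ℂ) (u : Fin 3 → Fin 3 → B) (a l : Fin 3) : B :=
  -- A twisted cofactor: `l + 1` and `l + 2` are the two columns other than `l`, and the scalar
  -- normalises the right-hand side of `det_star` to 1.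
  (conj (E l (l + 1) (l + 2)))⁻¹ • ∑ b, ∑ c, conj (E a b c) • (u b (l + 1) * u c (l + 2))

end TwistedUnitary

/-! ### Entries of the array along cyclic index patterns -/

namespace PermutationCondition

variable {E : Fin 3 → Fin 3 → Fin 3 → ℂ}

theorem cyclic_ne_zero (hE : PermutationCondition E) (l : Fin 3) : E l (l + 1) (l + 2) ≠ 0 := by
  rw [hE]; revert l; decide

theorem eq_zero_of_not (hE : PermutationCondition E) {i j k : Fin 3} (h : i = j ∨ j = k ∨ i = k) :
    E i j k = 0 := by
  by_contra h'
  rw [← ne_eq, hE] at h'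
  revert i j k; decide

theorem cyclic_eq_zero (hE : PermutationCondition E) {i l : Fin 3} (h : i ≠ l) :
    E i (l + 1) (l + 2) = 0 := by
  apply hE.eq_zero_of_not
  revert i l; decide

theorem cyclic_eq_zero' (hE : PermutationCondition E) {i l : Fin 3} (h : i ≠ l) :
    E (l + 1) (l + 2) i = 0 := by
  apply hE.eq_zero_of_not
  revert i l; decide

theorem cyclic_ne_zero' (hE : PermutationCondition E) (l : Fin 3) : E (l + 1) (l + 2) l ≠ 0 := by
  rw [hE]; revert l; decide

end PermutationCondition

/-! ### Two-sided invertibility of the transposed matrix -/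

namespace IsTwistedUnitary

variable {B : Type*} [Ring B] [StarRing B] [Algebra ℂ B] [StarModule ℂ B]
  {E : Fin 3 → Fin 3 → Fin 3 → ℂ} {u : Fin 3 → Fin 3 → B}

theorem sum_mul_transposeInv (h : IsTwistedUnitary E u) (hE : PermutationCondition E)
    (i l : Fin 3) : ∑ a, u a i * transposeInv E u a l = if i = l then 1 else 0 := by
  have h1 := h.det_star i (l + 1) (l + 2)
  simp_rw [transposeInv, mul_smul_comm, Finset.mul_sum, mul_smul_comm, ← mul_assoc,
    ← Finset.smul_sum, h1]
  split_ifs with hil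
  · subst hil
    rw [smul_smul, inv_mul_cancel₀, one_smul]
    exact (map_ne_zero _).2 (hE.cyclic_ne_zero i)
  · rw [hE.cyclic_eq_zero hil]; simp

/-- The right-hand counterpart of `quadratic`: the last factor of the determinant relation is
cancelled by the inverse of the transpose. -/
theorem quadratic_last (h : IsTwistedUnitary E u) (hE : PermutationCondition E) (a b l : Fin 3) :
    ∑ i, ∑ j, E i j l • (u a i * u b j) = ∑ c, E a b c • transposeInv E u c l := by
  have := eq_sum_of_right_inverse (U := fun k c => u c k) (h.sum_mul_transposeInv hE)
    (F := fun k => ∑ i, ∑ j, E i j k • (u a i * u b j)) (G := fun c => E a b c • (1 : B))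
    (fun c => by
      rw [← h.det a b c]
      simp only [Finset.sum_mul, smul_mul_assoc]
      simp only [Fin.sum_univ_three]
      abel) l
  simpa using this

/-- A one-sided inverse over a noncommutative ring need not be two-sided. Here `quadratic_last` with
rows `d + 1`, `d + 2` rewrites the candidate as a cofactor built from `E` instead of its conjugate,
and the determinant relations for `u` give the other side. -/
theorem sum_transposeInv_mul (h : IsTwistedUnitary E u) (hE : PermutationCondition E)
    (d c : Fin 3) : ∑ k, transposeInv E u d k * u c k = if d = c then 1 else 0 := by
  have h1 : ∀ k, transposeInv E u d k =
      (E (d + 1) (d + 2) d)⁻¹ • ∑ i, ∑ j, E i j k • (u (d + 1) i * u (d + 2) j) := fun k => by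
    rw [h.quadratic_last hE, Finset.sum_eq_single d, smul_smul,
      inv_mul_cancel₀ (hE.cyclic_ne_zero' d), one_smul]
    · intro c _ hc
      rw [hE.cyclic_eq_zero' hc, zero_smul]
    · simp
  have h2 := h.det (d + 1) (d + 2) c
  have h3 : ∑ k, (∑ i, ∑ j, E i j k • (u (d + 1) i * u (d + 2) j)) * u c k =
      E (d + 1) (d + 2) c • 1 := by
    rw [← h2]
    simp only [Finset.sum_mul, smul_mul_assoc]
    simp only [Fin.sum_univ_three]
    abel
  simp_rw [h1, smul_mul_assoc, ← Finset.smul_sum, h3]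
  split_ifs with hil
  · subst hil
    rw [smul_smul, inv_mul_cancel₀ (hE.cyclic_ne_zero' d), one_smul]
  · rw [hE.cyclic_eq_zero' (Ne.symm hil)]; simp

theorem quadratic_star_first (h : IsTwistedUnitary E u) (hE : PermutationCondition E)
    (a j k : Fin 3) : ∑ b, ∑ c, conj (E a b c) • (u b j * u c k) =
      ∑ i, conj (E i j k) • transposeInv E u a i := by
  have := eq_sum_of_left_inverse (U := fun i a => u a i) (h.sum_transposeInv_mul hE)
    (F := fun a => ∑ b, ∑ c, conj (E a b c) • (u b j * u c k))
    (G := fun i => conj (E i j k) • (1 : B))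
    (fun i => by
      rw [← h.det_star i j k]
      simp_rw [Finset.mul_sum, mul_smul_comm, mul_assoc]) a
  simpa using this

end IsTwistedUnitary

/-! ### The splitting of the matrix into blocks -/

namespace PermutationCondition

variable {E : Fin 3 → Fin 3 → Fin 3 → ℂ}

theorem apply_left (hE : PermutationCondition E) (i k : Fin 3) : E i i k = 0 :=
  hE.eq_zero_of_not (.inl rfl)

theorem apply_right (hE : PermutationCondition E) (i j : Fin 3) : E i j j = 0 :=
  hE.eq_zero_of_not (.inr (.inl rfl))

theorem apply_outer (hE : PermutationCondition E) (i j : Fin 3) : E i j i = 0 :=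
  hE.eq_zero_of_not (.inr (.inr rfl))

end PermutationCondition

/-- An array with `co(1,2) = 1` and `co(0,2) ≠ 1`, in terms of the products of the entries with
equal middle index. -/
structure IsSplitArray (E : Fin 3 → Fin 3 → Fin 3 → ℂ) : Prop where
  perm : PermutationCondition E
  mid_eq : E 0 1 2 * E 2 1 0 = E 0 2 1 * E 1 2 0
  mid_ne : E 1 0 2 * E 2 0 1 ≠ E 0 1 2 * E 2 1 0

namespace IsSplitArray

variable {E : Fin 3 → Fin 3 → Fin 3 → ℂ}

/-- Each characteristic constant is a quotient of two products of entries with equal middle index.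
-/
theorem of_charConst (hE : PermutationCondition E) (h₁ : charConst E 1 2 = 1)
    (h₀ : charConst E 0 2 ≠ 1) : IsSplitArray E := by
  have e012 : E 0 1 2 ≠ 0 := (hE 0 1 2).2 (by decide)
  have e021 : E 0 2 1 ≠ 0 := (hE 0 2 1).2 (by decide)
  have e102 : E 1 0 2 ≠ 0 := (hE 1 0 2).2 (by decide)
  have e120 : E 1 2 0 ≠ 0 := (hE 1 2 0).2 (by decide)
  have h1 : charConst E 1 2 = E 0 1 2 / E 0 2 1 * (E 2 1 0 / E 1 2 0) := rfl
  have h2 : charConst E 0 2 = E 1 0 2 / E 1 2 0 * (E 2 0 1 / E 0 2 1) := rfl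
  rw [h1] at h₁
  rw [h2] at h₀
  field_simp at h₁ h₀
  refine ⟨hE, h₁, fun h => h₀ ?_⟩
  rw [h, h₁]
  exact div_self (mul_ne_zero e021 e120)

/-- The hypotheses are symmetric in the indices 1 and 2, so each statement about index 1 transfers
to index 2. -/
theorem swap (h : IsSplitArray E) : IsSplitArray fun i j k =>
    E (Equiv.swap 1 2 i) (Equiv.swap 1 2 j) (Equiv.swap 1 2 k) where
  perm i j k := by
    rw [h.perm]; revert i j k; decide
  mid_eq := h.mid_eq.symm
  mid_ne := by
    have := h.mid_ne
    rw [h.mid_eq] at this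
    rw [ne_eq, mul_comm]
    exact mul_comm (E 1 0 2) _ ▸ this

end IsSplitArray

/-! ### Orthogonality relations and vanishing of the off-diagonal blocks -/

namespace IsTwistedUnitary

variable {B : Type*} [Ring B] [StarRing B] [Algebra ℂ B]
  {E : Fin 3 → Fin 3 → Fin 3 → ℂ} {u : Fin 3 → Fin 3 → B}

theorem reindex (h : IsTwistedUnitary E u) (σ : Equiv.Perm (Fin 3)) :
    IsTwistedUnitary (fun i j k => E (σ i) (σ j) (σ k)) fun i j => u (σ i) (σ j) where
  row j k := by
    rw [Equiv.sum_comp σ fun s => u (σ j) s * star (u (σ k) s), h.row]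
    simp
  col j k := by
    rw [Equiv.sum_comp σ fun s => star (u s (σ j)) * u s (σ k), h.col]
    simp
  det a b c := by
    symm
    rw [← h.det, ← Equiv.sum_comp σ]
    refine Finset.sum_congr rfl fun i _ => ?_
    rw [← Equiv.sum_comp σ]
    refine Finset.sum_congr rfl fun j _ => ?_
    rw [← Equiv.sum_comp σ]

variable [StarModule ℂ B]

/-- `E` vanishes on repeated indices, so `quadratic` and `quadratic_last` with equal row indices
become homogeneous equations in the two products. The determinant of this system is nonzero by
`mid_ne`. -/
theorem row_one_orthogonal (h : IsTwistedUnitary E u) (hE : IsSplitArray E) (a : Fin 3) :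
    u a 0 * u a 1 = 0 ∧ u a 1 * u a 0 = 0 := by
  have h1 := h.quadratic 2 a a
  have h2 := h.quadratic_last hE.perm a a 2
  simp only [Fin.sum_univ_three, hE.perm.apply_left, hE.perm.apply_right, hE.perm.apply_outer,
    zero_smul, add_zero, zero_add] at h1 h2
  refine eq_zero_of_smul_add_smul h1 h2 fun h0 => hE.mid_ne ?_
  linear_combination h0

theorem row_two_orthogonal (h : IsTwistedUnitary E u) (hE : IsSplitArray E) (a : Fin 3) :
    u a 0 * u a 2 = 0 ∧ u a 2 * u a 0 = 0 :=
  (h.reindex (Equiv.swap 1 2)).row_one_orthogonal hE.swap (Equiv.swap 1 2 a) |>.imp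
    (by simp [show Equiv.swap (1 : Fin 3) 2 0 = 0 by decide])
    (by simp [show Equiv.swap (1 : Fin 3) 2 0 = 0 by decide])

theorem col_one_orthogonal (h : IsTwistedUnitary E u) (hE : IsSplitArray E) (i : Fin 3) :
    u 0 i * u 1 i = 0 ∧ u 1 i * u 0 i = 0 := by
  have h1 := h.quadratic_star 2 i i
  have h2 := h.quadratic_star_first hE.perm 2 i i
  simp only [Fin.sum_univ_three, hE.perm.apply_left, hE.perm.apply_right, hE.perm.apply_outer,
    zero_smul, add_zero, zero_add, map_zero] at h1 h2
  refine eq_zero_of_smul_add_smul h1 h2 fun h0 => hE.mid_ne ?_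
  rw [← map_mul, ← map_mul, ← map_sub, map_eq_zero] at h0
  linear_combination -h0

theorem sq_mul_star (h : IsTwistedUnitary E u) (hE : IsSplitArray E) :
    u 0 0 * (u 0 0 * star (u 0 0)) = u 0 0 := by
  have h1 := congrArg (u 0 0 * ·) (h.row 0 0)
  simpa [Fin.sum_univ_three, mul_add, ← mul_assoc (u 0 0) (u 0 1),
    ← mul_assoc (u 0 0) (u 0 2), (h.row_one_orthogonal hE 0).1,
    (h.row_two_orthogonal hE 0).1] using h1

/-- Left multiplication by `u 1 0` annihilates the adjoints of the whole row 0, and that row of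
adjoints has a right inverse coming from `transposeInv`. -/
theorem apply_one_zero (h : IsTwistedUnitary E u) (hE : IsSplitArray E) : u 1 0 = 0 := by
  have e012 : E 0 1 2 ≠ 0 := (hE.perm 0 1 2).2 (by decide)
  have e021 : E 0 2 1 ≠ 0 := (hE.perm 0 2 1).2 (by decide)
  have e210 : E 2 1 0 ≠ 0 := (hE.perm 2 1 0).2 (by decide)
  have e120 : E 1 2 0 ≠ 0 := (hE.perm 1 2 0).2 (by decide)
  have hr1 := (h.row_one_orthogonal hE 1).1
  have hr2 := (h.row_two_orthogonal hE 1).1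
  -- This lets `u 1 0` pass `u 2 0` up to a scalar, so that row orthogonality also kills words with
  -- `u 2 0` in between.
  have hc : u 1 0 * u 2 0 = -((conj (E 1 2 0))⁻¹ * conj (E 2 1 0)) • (u 2 0 * u 1 0) := by
    have h1 := h.quadratic_star 0 0 0
    simp only [Fin.sum_univ_three, hE.perm.apply_left, hE.perm.apply_right, hE.perm.apply_outer,
      zero_smul, add_zero, zero_add, map_zero] at h1
    have h2 : conj (E 1 2 0) ≠ 0 := (map_ne_zero _).2 e120
    rw [← smul_right_inj h2, eq_neg_of_add_eq_zero_left h1, smul_smul]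
    rw [mul_neg, mul_inv_cancel_left₀ h2, neg_smul]
  have kill1 : ∀ x, u 1 0 * (u 1 1 * x) = 0 := fun x => by rw [← mul_assoc, hr1, zero_mul]
  have kill2 : ∀ x, u 1 0 * (u 1 2 * x) = 0 := fun x => by rw [← mul_assoc, hr2, zero_mul]
  have kill3 : u 1 0 * (u 2 0 * u 1 1) = 0 := by
    rw [← mul_assoc, hc, smul_mul_assoc, mul_assoc, hr1, mul_zero, smul_zero]
  have kill4 : u 1 0 * (u 2 0 * u 1 2) = 0 := by
    rw [← mul_assoc, hc, smul_mul_assoc, mul_assoc, hr2, mul_zero, smul_zero]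
  have s0 : u 1 0 * star (u 0 0) = 0 := by
    have h1 := congrArg star (h.sq_mul_star hE)
    simp only [star_mul, star_star] at h1
    rw [← h1, mul_assoc, ← mul_assoc, (h.col_one_orthogonal hE 0).2, zero_mul]
  -- After the kills, four homogeneous equations remain in `u 1 0 * (u 1 0 * u 2 2)`, `u 1 0 * (u 2
  -- 2 * u 1 0)`, `u 1 0 * star (u 0 1)` and `u 1 0 * transposeInv E u 0 1`. Eliminating all but the
  -- third leaves the factor `E_021 (m_1 - m_0)`.
  have s1 : u 1 0 * star (u 0 1) = 0 := by
    have h1 := congrArg (u 1 0 * ·) (h.quadratic 1 1 2)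
    have h2 := congrArg (u 1 0 * ·) (h.quadratic 1 2 1)
    have h3 := congrArg (u 1 0 * ·) (h.quadratic_last hE.perm 1 2 1)
    have h4 := congrArg (u 1 0 * ·) (h.quadratic_last hE.perm 2 1 1)
    simp only [Fin.sum_univ_three, hE.perm.apply_left, hE.perm.apply_right, hE.perm.apply_outer,
      zero_smul, add_zero, zero_add, mul_add, mul_smul_comm, kill2, kill4, smul_zero]
      at h1 h2 h3 h4
    have h5 : E 0 2 1 * (E 0 1 2 * E 2 1 0 - E 1 0 2 * E 2 0 1) ≠ 0 :=
      mul_ne_zero e021 (sub_ne_zero.2 hE.mid_ne.symm)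
    refine (smul_eq_zero.1 ?_).resolve_left h5
    linear_combination (norm := module) (-(E 2 1 0 * E 0 2 1)) • h1 + (E 2 0 1 * E 1 0 2) • h2 +
      (E 2 1 0 * E 1 0 2) • h3 - (E 1 2 0 * E 1 0 2) • h4
  -- The same elimination now leaves `m_1² - m_2 m_0`, which equals `m_1 (m_1 - m_0)` by `mid_eq`.
  have s2 : u 1 0 * star (u 0 2) = 0 := by
    have h1 := congrArg (u 1 0 * ·) (h.quadratic 2 1 2)
    have h2 := congrArg (u 1 0 * ·) (h.quadratic 2 2 1)
    have h3 := congrArg (u 1 0 * ·) (h.quadratic_last hE.perm 1 2 2)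
    have h4 := congrArg (u 1 0 * ·) (h.quadratic_last hE.perm 2 1 2)
    simp only [Fin.sum_univ_three, hE.perm.apply_left, hE.perm.apply_right, hE.perm.apply_outer,
      zero_smul, add_zero, zero_add, mul_add, mul_smul_comm, kill1, kill3, smul_zero]
      at h1 h2 h3 h4
    have h5 : (E 0 1 2 * E 2 1 0) * (E 0 1 2 * E 2 1 0 - E 1 0 2 * E 2 0 1) ≠ 0 :=
      mul_ne_zero (mul_ne_zero e012 e210) (sub_ne_zero.2 hE.mid_ne.symm)
    refine (smul_eq_zero.1 ?_).resolve_left h5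
    have h6 : (E 0 1 2 * E 2 1 0) * (E 0 1 2 * E 2 1 0 - E 1 0 2 * E 2 0 1) =
        (E 0 1 2 * E 2 1 0) * (E 0 1 2 * E 2 1 0) - E 0 2 1 * E 1 2 0 * (E 1 0 2 * E 2 0 1) := by
      linear_combination -E 1 0 2 * E 2 0 1 * hE.mid_eq
    rw [h6]
    linear_combination (norm := module) (-(E 2 1 0 * E 2 1 0 * E 0 1 2)) • h1 +
      (E 1 2 0 * E 1 0 2 * E 2 0 1) • h2 +
      (E 2 1 0 * E 2 1 0 * E 2 0 1) • h3 - (E 1 2 0 * E 2 1 0 * E 2 0 1) • h4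
  -- The adjoint of this relation reads `∑ u_0k* V_0k* = 1`; by `s0`, `s1`, `s2`, left
  -- multiplication by `u 1 0` gives zero on one side and `u 1 0` on the other.
  have h1 := congrArg star (h.sum_transposeInv_mul hE.perm 0 0)
  simp only [Fin.sum_univ_three, star_add, star_mul, if_true, star_one] at h1
  have h2 := congrArg (u 1 0 * ·) h1
  simpa [mul_add, ← mul_assoc, s0, s1, s2] using h2.symm

theorem apply_two_zero (h : IsTwistedUnitary E u) (hE : IsSplitArray E) : u 2 0 = 0 :=
  (h.reindex (Equiv.swap 1 2)).apply_one_zero hE.swap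

theorem star_mul_self_zero_zero (h : IsTwistedUnitary E u) (hE : IsSplitArray E) :
    star (u 0 0) * u 0 0 = 1 := by
  simpa [Fin.sum_univ_three, h.apply_one_zero hE, h.apply_two_zero hE] using h.col 0 0

theorem mul_star_self_zero_zero (h : IsTwistedUnitary E u) (hE : IsSplitArray E) :
    u 0 0 * star (u 0 0) = 1 := by
  have h1 := congrArg (star (u 0 0) * ·) (h.sq_mul_star hE)
  simpa only [← mul_assoc, h.star_mul_self_zero_zero hE, one_mul] using h1

theorem apply_zero_one (h : IsTwistedUnitary E u) (hE : IsSplitArray E) : u 0 1 = 0 := by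
  rw [← one_mul (u 0 1), ← h.star_mul_self_zero_zero hE, mul_assoc,
    (h.row_one_orthogonal hE 0).1, mul_zero]

theorem apply_zero_two (h : IsTwistedUnitary E u) (hE : IsSplitArray E) : u 0 2 = 0 :=
  (h.reindex (Equiv.swap 1 2)).apply_zero_one hE.swap

end IsTwistedUnitary

/-! ### The relations of `U_q(2)` -/

/-- Makes the phase in the last relation rational in `q` and its conjugate, so that coefficients can
be compared by field arithmetic. -/
theorem exp_neg_two_mul_arg {q : ℂ} (hq : q ≠ 0) :
    Complex.exp (-2 * Complex.I * (Complex.arg q : ℂ)) = conj q / q := by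
  have h1 := Complex.norm_mul_exp_arg_mul_I q
  have h2 : conj q = ‖q‖ * Complex.exp (-(Complex.arg q * Complex.I)) := by
    conv_lhs => rw [← h1]
    rw [map_mul, Complex.conj_ofReal, ← Complex.exp_conj, map_mul, Complex.conj_ofReal,
      Complex.conj_I, mul_neg]
  rw [eq_div_iff hq, h2]
  generalize Complex.arg q = θ at h1 h2
  calc Complex.exp (-2 * Complex.I * θ) * q
      = ‖q‖ * (Complex.exp (-2 * Complex.I * θ) * Complex.exp (θ * Complex.I)) := by
        rw [mul_left_comm, h1]
    _ = ‖q‖ * Complex.exp (-(θ * Complex.I)) := by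
        rw [← Complex.exp_add]; ring_nf

/-- The relations of the generators of `C(U_q(2))`. -/
structure IsUqTriple {B : Type*} [Ring B] [StarRing B] [Algebra ℂ B] (q : ℂ) (a c v : B) :
    Prop where
  ac : a * c = conj q • (c * a)
  ac_star : a * star c = q • (star c * a)
  star_a_a : star a * a + star c * c = 1
  a_star_a : a * star a + ((‖q‖ : ℂ) ^ 2) • (star c * c) = 1
  c_normal : c * star c = star c * c
  v_star_v : v * star v = 1
  star_v_v : star v * v = 1
  av : a * v = v * a
  cv : c * v = (conj q / q) • (v * c)

section

variable {B : Type*} [Ring B] [StarRing B] [Algebra ℂ B] [StarModule ℂ B]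
  {E : Fin 3 → Fin 3 → Fin 3 → ℂ} {u : Fin 3 → Fin 3 → B}

theorem forall_mem_uqRelations {q : ℂ} (hq : q ≠ 0) (f : UqGen → B) :
    (∀ r ∈ uqRelations q, FreeStarAlgebra.lift f r = 0) ↔
      IsUqTriple q (f UqGen.a) (f UqGen.c) (f UqGen.v) := by
  rw [uqRelations, exp_neg_two_mul_arg hq]
  simp only [Set.mem_insert_iff, Set.mem_singleton_iff, forall_eq_or_imp, forall_eq, map_sub,
    map_add, map_mul, map_smul, map_one, map_star, FreeStarAlgebra.lift_gen, sub_eq_zero]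
  constructor
  · rintro ⟨h1, h2, h3, h4, h5, h6, h7, h8, h9⟩
    exact ⟨h1, h2, h3, h4, h5, h6, h7, h8, h9⟩
  · rintro ⟨h1, h2, h3, h4, h5, h6, h7, h8, h9⟩
    exact ⟨h1, h2, h3, h4, h5, h6, h7, h8, h9⟩

theorem forall_mem_woronowiczRelations (f : Fin 3 × Fin 3 → B) :
    (∀ r ∈ woronowiczRelations E, FreeStarAlgebra.lift f r = 0) ↔
      IsTwistedUnitary E fun j k => f (j, k) := by
  have key : ∀ (j k : Fin 3), FreeStarAlgebra.lift f (if j = k then 1 else 0) =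
      if j = k then 1 else 0 := fun j k => by split_ifs <;> simp
  constructor
  · intro h
    refine ⟨fun j k => ?_, fun j k => ?_, fun a b c => ?_⟩
    · have := h _ (Or.inl (Or.inl ⟨j, k, rfl⟩))
      simpa only [map_sub, map_sum, map_mul, map_star, FreeStarAlgebra.lift_gen, key,
        sub_eq_zero] using this
    · have := h _ (Or.inl (Or.inr ⟨j, k, rfl⟩))
      simpa only [map_sub, map_sum, map_mul, map_star, FreeStarAlgebra.lift_gen, key,
        sub_eq_zero] using this
    · have := h _ (Or.inr ⟨a, b, c, rfl⟩)
      simpa only [map_sub, map_sum, map_mul, map_smul, map_one, FreeStarAlgebra.lift_gen,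
        sub_eq_zero] using this
  · rintro h r ((⟨j, k, rfl⟩ | ⟨j, k, rfl⟩) | ⟨a, b, c, rfl⟩)
    · simpa only [map_sub, map_sum, map_mul, map_star, FreeStarAlgebra.lift_gen, key,
        sub_eq_zero] using h.row j k
    · simpa only [map_sub, map_sum, map_mul, map_star, FreeStarAlgebra.lift_gen, key,
        sub_eq_zero] using h.col j k
    · simpa only [map_sub, map_sum, map_mul, map_smul, map_one, FreeStarAlgebra.lift_gen,
        sub_eq_zero] using h.det a b c

/-! #### From the twisted unitary matrix to the triple -/

/-- The parameter of the quantum group `U_q(2)` that belongs to the array `E`. -/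
def uqParam (E : Fin 3 → Fin 3 → Fin 3 → ℂ) : ℂ := -(E 2 1 0 / E 1 2 0)

namespace IsSplitArray

theorem uqParam_ne_zero (hE : IsSplitArray E) : uqParam E ≠ 0 :=
  neg_ne_zero.2 (div_ne_zero ((hE.perm 2 1 0).2 (by decide)) ((hE.perm 1 2 0).2 (by decide)))

theorem apply_two_one_zero (hE : IsSplitArray E) : E 2 1 0 = -uqParam E * E 1 2 0 := by
  have : E 1 2 0 ≠ 0 := (hE.perm 1 2 0).2 (by decide)
  rw [uqParam]; field_simp

/-- By `mid_eq`, the same parameter governs the ratios `E_210 / E_120` and `E_021 / E_012`. -/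
theorem apply_zero_two_one (hE : IsSplitArray E) : E 0 2 1 = -uqParam E * E 0 1 2 := by
  have : E 1 2 0 ≠ 0 := (hE.perm 1 2 0).2 (by decide)
  rw [uqParam]; field_simp
  linear_combination -hE.mid_eq

end IsSplitArray

namespace IsTwistedUnitary

theorem two_two_mul (h : IsTwistedUnitary E u) (hE : IsSplitArray E) :
    u 2 2 * u 0 0 = star (u 1 1) := by
  have h1 := h.quadratic 1 2 0
  simp only [Fin.sum_univ_three, hE.perm.apply_left, hE.perm.apply_right, hE.perm.apply_outer,
    zero_smul, add_zero, zero_add, h.apply_zero_two hE, mul_zero, smul_zero] at h1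
  exact (smul_right_inj ((hE.perm 1 2 0).2 (by decide))).1 h1

theorem mul_two_two (h : IsTwistedUnitary E u) (hE : IsSplitArray E) :
    u 0 0 * u 2 2 = star (u 1 1) := by
  have h1 := h.quadratic 1 0 2
  simp only [Fin.sum_univ_three, hE.perm.apply_left, hE.perm.apply_right, hE.perm.apply_outer,
    zero_smul, add_zero, zero_add, h.apply_zero_two hE, zero_mul, smul_zero] at h1
  exact (smul_right_inj ((hE.perm 1 0 2).2 (by decide))).1 h1

theorem apply_two_two (h : IsTwistedUnitary E u) (hE : IsSplitArray E) :
    u 2 2 = star (u 1 1) * star (u 0 0) := by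
  rw [← h.two_two_mul hE, mul_assoc, h.mul_star_self_zero_zero hE, mul_one]

/-- Solving `two_two_mul` and `mul_two_two` for `u 2 2` gives two expressions whose equality is the
adjoint of the claim. -/
theorem one_one_comm (h : IsTwistedUnitary E u) (hE : IsSplitArray E) :
    u 1 1 * u 0 0 = u 0 0 * u 1 1 := by
  have h1 : u 2 2 = star (u 0 0) * star (u 1 1) := by
    rw [← h.mul_two_two hE, ← mul_assoc, h.star_mul_self_zero_zero hE, one_mul]
  have h2 := congrArg star ((h.apply_two_two hE).symm.trans h1)
  simpa using h2.symm

theorem one_two_mul (h : IsTwistedUnitary E u) (hE : IsSplitArray E) :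
    u 1 2 * u 0 0 = -(uqParam E • star (u 2 1)) := by
  have h1 := h.quadratic 1 1 0
  have h2 : E 1 2 0 ≠ 0 := (hE.perm 1 2 0).2 (by decide)
  simp only [Fin.sum_univ_three, hE.perm.apply_left, hE.perm.apply_right, hE.perm.apply_outer,
    zero_smul, add_zero, zero_add, h.apply_zero_two hE, mul_zero, smul_zero,
    hE.apply_two_one_zero] at h1
  rw [← smul_right_inj h2, h1]
  module

/-- The parameter appears conjugated here and unconjugated in `one_two_mul`; this discrepancy
produces the phase in the relation between `c` and `v`. -/
theorem mul_one_two (h : IsTwistedUnitary E u) (hE : IsSplitArray E) :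
    u 0 0 * u 1 2 = -(conj (uqParam E) • star (u 2 1)) := by
  have h1 := h.quadratic_star 2 0 2
  have h2 : conj (E 0 1 2) ≠ 0 := (map_ne_zero _).2 ((hE.perm 0 1 2).2 (by decide))
  simp only [Fin.sum_univ_three, hE.perm.apply_left, hE.perm.apply_right, hE.perm.apply_outer,
    zero_smul, add_zero, zero_add, map_zero, h.apply_one_zero hE, zero_mul, smul_zero,
    hE.apply_zero_two_one] at h1
  rw [← smul_right_inj h2, h1, map_mul, map_neg]
  module

theorem apply_one_two (h : IsTwistedUnitary E u) (hE : IsSplitArray E) :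
    u 1 2 = -(uqParam E • (star (u 2 1) * star (u 0 0))) := by
  rw [← smul_mul_assoc, ← neg_mul, ← h.one_two_mul hE, mul_assoc, h.mul_star_self_zero_zero hE,
    mul_one]

/-- `quadratic` and `mul_one_two` both evaluate `u 0 0 * u 1 2` as a multiple of `star (u 2 1)`;
different multiples force it to vanish. -/
theorem apply_two_one (h : IsTwistedUnitary E u) (hE : IsSplitArray E)
    (hk : E 2 0 1 ≠ -conj (uqParam E) * E 1 0 2) : u 2 1 = 0 := by
  have h1 := h.quadratic 1 0 1
  simp only [Fin.sum_univ_three, hE.perm.apply_left, hE.perm.apply_right, hE.perm.apply_outer,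
    zero_smul, add_zero, zero_add, h.apply_zero_two hE, zero_mul, smul_zero,
    h.mul_one_two hE] at h1
  have h2 : (E 2 0 1 + conj (uqParam E) * E 1 0 2) • star (u 2 1) = 0 := by
    rw [add_smul, ← h1]
    module
  refine star_eq_zero.1 ((smul_eq_zero.1 h2).resolve_left fun h3 => hk ?_)
  linear_combination h3

theorem isUqTriple (h : IsTwistedUnitary E u) (hE : IsSplitArray E) :
    IsUqTriple (uqParam E) (u 1 1) (u 2 1) (u 0 0) := by
  have hq := hE.uqParam_ne_zero
  have col1 := h.col 1 1
  have row1 := h.row 1 1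
  have row2 := h.row 2 2
  simp only [Fin.sum_univ_three, h.apply_zero_one hE, h.apply_one_zero hE, h.apply_two_zero hE,
    mul_zero, zero_mul, zero_add, if_true] at col1 row1 row2
  rw [h.apply_one_two hE] at row1
  rw [h.apply_two_two hE] at row2
  simp only [star_neg, star_smul, star_mul, star_star, neg_mul_neg, smul_mul_smul_comm,
    mul_assoc] at row1 row2
  rw [← mul_assoc (star (u 0 0)), h.star_mul_self_zero_zero hE, one_mul] at row1 row2
  refine ⟨?_, ?_, col1, ?_, ?_, h.mul_star_self_zero_zero hE, h.star_mul_self_zero_zero hE,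
    h.one_one_comm hE, ?_⟩
  · have h1 := h.quadratic_star 0 1 1
    have h2 : conj (E 1 2 0) ≠ 0 := (map_ne_zero _).2 ((hE.perm 1 2 0).2 (by decide))
    simp only [Fin.sum_univ_three, hE.perm.apply_left, hE.perm.apply_right, hE.perm.apply_outer,
      zero_smul, add_zero, zero_add, map_zero, hE.apply_two_one_zero, map_mul, map_neg] at h1
    rw [← smul_right_inj h2, eq_neg_of_add_eq_zero_left h1]
    module
  -- The commutation relation first appears between `a` and `u 1 2`. Right multiplication by `v`
  -- turns `u 1 2` into `-q c*`, and one factor `q` cancels.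
  · have h1 := h.quadratic 0 1 1
    have h2 : E 0 1 2 ≠ 0 := (hE.perm 0 1 2).2 (by decide)
    simp only [Fin.sum_univ_three, hE.perm.apply_left, hE.perm.apply_right, hE.perm.apply_outer,
      zero_smul, add_zero, zero_add, hE.apply_zero_two_one] at h1
    have h3 : u 1 1 * u 1 2 = uqParam E • (u 1 2 * u 1 1) := by
      rw [← smul_right_inj h2, eq_neg_of_add_eq_zero_left h1]
      module
    have h4 := congrArg (· * u 0 0) h3
    simp only [smul_mul_assoc, mul_assoc, h.one_one_comm hE] at h4
    rw [h.one_two_mul hE, ← mul_assoc, h.one_two_mul hE] at h4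
    have h5 : uqParam E • (u 1 1 * star (u 2 1)) =
        uqParam E • (uqParam E • (star (u 2 1) * u 1 1)) := by
      simpa using h4
    exact (smul_right_inj hq).1 h5
  · rw [← row1, ← Complex.mul_conj']; rfl
  -- Row 2 and column 1 express `c c*` and `c* c` both as `1 - a* a`.
  · rw [← add_left_inj (star (u 1 1) * u 1 1), row2, ← col1, add_comm]
  -- The word `v u_12 v` is evaluated with both bracketings; the adjoint is then multiplied by `v`
  -- on both sides.
  · have h1 := congrArg (· * u 0 0) (h.mul_one_two hE)
    simp only [mul_assoc, h.one_two_mul hE] at h1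
    have h2 := congrArg star h1
    simp only [mul_neg, neg_mul, star_neg, neg_inj, mul_smul_comm, smul_mul_assoc, star_smul,
      star_mul, star_star] at h2
    have h3 := congrArg (u 0 0 * · * u 0 0) h2
    simp only [mul_smul_comm, smul_mul_assoc, mul_assoc, h.star_mul_self_zero_zero hE, mul_one]
      at h3
    simp only [← mul_assoc, h.mul_star_self_zero_zero hE, one_mul] at h3
    rw [← smul_right_inj hq, smul_smul, mul_div_cancel₀ _ hq]
    simpa using h3.symm

end IsTwistedUnitary

end

section

variable {B : Type*} [Ring B] [StarRing B] [Algebra ℂ B]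
  {E : Fin 3 → Fin 3 → Fin 3 → ℂ} {u : Fin 3 → Fin 3 → B}

/-! #### From the triple to the twisted unitary matrix -/

/-- The fundamental corepresentation of `U_q(2)`. -/
def uqTripleMatrix {B : Type*} [Ring B] [StarRing B] [Algebra ℂ B] (q : ℂ) (a c v : B) :
    Matrix (Fin 3) (Fin 3) B :=
  !![v, 0, 0; 0, a, -(q • (star c * star v)); 0, c, star a * star v]

namespace IsUqTriple

variable {q : ℂ} {a c v : B}

theorem ca (h : IsUqTriple q a c v) (hq : q ≠ 0) : c * a = (conj q)⁻¹ • (a * c) := by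
  rw [h.ac, smul_smul, inv_mul_cancel₀ ((map_ne_zero _).2 hq), one_smul]

theorem star_ca (h : IsUqTriple q a c v) (hq : q ≠ 0) : star c * a = q⁻¹ • (a * star c) := by
  rw [h.ac_star, smul_smul, inv_mul_cancel₀ hq, one_smul]

theorem star_c_star_a [StarModule ℂ B] (h : IsUqTriple q a c v) :
    star c * star a = q • (star a * star c) := by
  simpa using congrArg star h.ac

theorem c_star_a [StarModule ℂ B] (h : IsUqTriple q a c v) :
    c * star a = conj q • (star a * c) := by
  simpa using congrArg star h.ac_star

theorem va_star (h : IsUqTriple q a c v) : star v * a = a * star v := by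
  calc star v * a = star v * (a * v) * star v := by
        rw [mul_assoc, mul_assoc, h.v_star_v, mul_one]
    _ = a * star v := by rw [h.av, ← mul_assoc, h.star_v_v, one_mul]

theorem v_star_a (h : IsUqTriple q a c v) : v * star a = star a * v := by
  simpa using (congrArg star h.va_star).symm

theorem star_v_star_a (h : IsUqTriple q a c v) : star v * star a = star a * star v := by
  simpa using congrArg star h.av

theorem vc (h : IsUqTriple q a c v) (hq : q ≠ 0) : v * c = (q / conj q) • (c * v) := by
  rw [h.cv, smul_smul, div_mul_div_cancel₀ ((map_ne_zero _).2 hq), div_self hq, one_smul]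

theorem star_v_c (h : IsUqTriple q a c v) : star v * c = (conj q / q) • (c * star v) := by
  calc star v * c = star v * (c * v) * star v := by
        rw [mul_assoc, mul_assoc, h.v_star_v, mul_one]
    _ = _ := by
        rw [h.cv, mul_smul_comm, ← mul_assoc, h.star_v_v, one_mul, smul_mul_assoc]

theorem star_v_star_c [StarModule ℂ B] (h : IsUqTriple q a c v) :
    star v * star c = (q / conj q) • (star c * star v) := by
  simpa using congrArg star h.cv

theorem v_star_c [StarModule ℂ B] (h : IsUqTriple q a c v) (hq : q ≠ 0) :
    v * star c = (conj q / q) • (star c * v) := by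
  have h1 : (q / conj q) • (v * star c) = star c * v := by
    simpa using (congrArg star h.star_v_c).symm
  rw [← h1, smul_smul, div_mul_div_cancel₀ hq, div_self ((map_ne_zero _).2 hq), one_smul]

-- By `of_quadratic` it suffices to check unitarity and quadratic identities. The relations serve as
-- rewriting rules to a normal order, with letters `a`, `a*` first, then `c*`, `c`, then `v`, `v*`,
-- where `a a*` and `a* a` are replaced by expressions in `c* c`. Each entry then becomes an
-- identity between scalar coefficients.
set_option linter.unusedSimpArgs false in
theorem isTwistedUnitary [StarModule ℂ B] (hE : IsSplitArray E)
    (hk : E 2 0 1 = -conj (uqParam E) * E 1 0 2) (h : IsUqTriple (uqParam E) a c v) :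
    IsTwistedUnitary E (uqTripleMatrix (uqParam E) a c v) := by
  have hq := hE.uqParam_ne_zero
  have e1 := hE.apply_two_one_zero
  have e2 := hE.apply_zero_two_one
  have u00 : uqTripleMatrix (uqParam E) a c v 0 0 = v := rfl
  have u01 : uqTripleMatrix (uqParam E) a c v 0 1 = 0 := rfl
  have u02 : uqTripleMatrix (uqParam E) a c v 0 2 = 0 := rfl
  have u10 : uqTripleMatrix (uqParam E) a c v 1 0 = 0 := rfl
  have u11 : uqTripleMatrix (uqParam E) a c v 1 1 = a := rfl
  have u12 : uqTripleMatrix (uqParam E) a c v 1 2 = -(uqParam E • (star c * star v)) := rfl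
  have u20 : uqTripleMatrix (uqParam E) a c v 2 0 = 0 := rfl
  have u21 : uqTripleMatrix (uqParam E) a c v 2 1 = c := rfl
  have u22 : uqTripleMatrix (uqParam E) a c v 2 2 = star a * star v := rfl
  generalize uqTripleMatrix (uqParam E) a c v = u at *
  generalize uqParam E = q at *
  have hq' : conj q ≠ 0 := (map_ne_zero _).2 hq
  have aa : a * star a = 1 - (q * conj q) • (star c * c) := by
    rw [Complex.mul_conj', ← h.a_star_a, add_sub_cancel_right]
  have aa' : star a * a = 1 - star c * c := by
    rw [← h.star_a_a, add_sub_cancel_right]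
  have forall_fin : ∀ {P : Fin 3 → Prop}, P 0 → P 1 → P 2 → ∀ i, P i := fun h0 h1 h2 i => by
    fin_cases i <;> assumption
  -- Products are kept right-associated, so each rule `x * y = z` is also needed in front of a tail
  -- `w`.
  have l : ∀ {x y z : B}, x * y = z → ∀ w, x * (y * w) = z * w := fun h w => by
    rw [← mul_assoc, h]
  refine .of_quadratic (fun j k => ?_) (fun j k => ?_) fun p b c => ?_
  · revert k j
    refine forall_fin (forall_fin ?_ ?_ ?_) (forall_fin ?_ ?_ ?_) (forall_fin ?_ ?_ ?_) <;>
    simp only [Fin.sum_univ_three, u00, u01, u02, u10, u11, u12, u20, u21, u22, star_zero,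
      mul_zero, zero_mul, add_zero, zero_add, hE.perm.apply_left, hE.perm.apply_right,
      hE.perm.apply_outer, zero_smul, smul_zero, h.star_v_v, h.v_star_v, Fin.reduceEq, if_true,
      if_false, e1, e2, hk]
    all_goals try simp only [star_neg, star_smul, star_mul, star_star, neg_mul, mul_neg, neg_neg,
      smul_mul_assoc, mul_smul_comm, smul_smul, mul_assoc, one_mul, mul_one, sub_mul, mul_sub,
      mul_zero, smul_zero, neg_zero, smul_neg, smul_sub, Complex.star_def,
      h.star_v_v, h.v_star_v, h.star_v_c, h.star_v_star_c, h.star_v_star_a, h.va_star, h.v_star_a,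
      h.vc hq, h.v_star_c hq, ← h.av, h.ca hq, h.star_ca hq, h.star_c_star_a, h.c_star_a,
      h.c_normal, aa, aa',
      l h.star_v_v, l h.v_star_v, l h.star_v_c, l h.star_v_star_c, l h.star_v_star_a,
      l h.va_star, l h.v_star_a, l (h.vc hq), l (h.v_star_c hq), l h.av.symm, l (h.ca hq),
      l (h.star_ca hq), l h.star_c_star_a, l h.c_star_a, l h.c_normal, l aa, l aa']
    all_goals first | (match_scalars <;> field_simp <;> ring) | abel
  · revert k j
    refine forall_fin (forall_fin ?_ ?_ ?_) (forall_fin ?_ ?_ ?_) (forall_fin ?_ ?_ ?_) <;>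
    simp only [Fin.sum_univ_three, u00, u01, u02, u10, u11, u12, u20, u21, u22, star_zero,
      mul_zero, zero_mul, add_zero, zero_add, hE.perm.apply_left, hE.perm.apply_right,
      hE.perm.apply_outer, zero_smul, smul_zero, h.star_v_v, h.v_star_v, Fin.reduceEq, if_true,
      if_false, e1, e2, hk]
    all_goals try simp only [star_neg, star_smul, star_mul, star_star, neg_mul, mul_neg, neg_neg,
      smul_mul_assoc, mul_smul_comm, smul_smul, mul_assoc, one_mul, mul_one, sub_mul, mul_sub,
      mul_zero, smul_zero, neg_zero, smul_neg, smul_sub, Complex.star_def,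
      h.star_v_v, h.v_star_v, h.star_v_c, h.star_v_star_c, h.star_v_star_a, h.va_star, h.v_star_a,
      h.vc hq, h.v_star_c hq, ← h.av, h.ca hq, h.star_ca hq, h.star_c_star_a, h.c_star_a,
      h.c_normal, aa, aa',
      l h.star_v_v, l h.v_star_v, l h.star_v_c, l h.star_v_star_c, l h.star_v_star_a,
      l h.va_star, l h.v_star_a, l (h.vc hq), l (h.v_star_c hq), l h.av.symm, l (h.ca hq),
      l (h.star_ca hq), l h.star_c_star_a, l h.c_star_a, l h.c_normal, l aa, l aa']
    all_goals first | (match_scalars <;> field_simp <;> ring) | abel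
  · revert c b p
    refine forall_fin
      (forall_fin (forall_fin ?_ ?_ ?_) (forall_fin ?_ ?_ ?_) (forall_fin ?_ ?_ ?_))
      (forall_fin (forall_fin ?_ ?_ ?_) (forall_fin ?_ ?_ ?_) (forall_fin ?_ ?_ ?_))
      (forall_fin (forall_fin ?_ ?_ ?_) (forall_fin ?_ ?_ ?_) (forall_fin ?_ ?_ ?_)) <;>
    simp only [Fin.sum_univ_three, u00, u01, u02, u10, u11, u12, u20, u21, u22, star_zero,
      mul_zero, zero_mul, add_zero, zero_add, hE.perm.apply_left, hE.perm.apply_right,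
      hE.perm.apply_outer, zero_smul, smul_zero, h.star_v_v, h.v_star_v, Fin.reduceEq, if_true,
      if_false, e1, e2, hk]
    all_goals try simp only [star_neg, star_smul, star_mul, star_star, neg_mul, mul_neg, neg_neg,
      smul_mul_assoc, mul_smul_comm, smul_smul, mul_assoc, one_mul, mul_one, sub_mul, mul_sub,
      mul_zero, smul_zero, neg_zero, smul_neg, smul_sub, Complex.star_def,
      h.star_v_v, h.v_star_v, h.star_v_c, h.star_v_star_c, h.star_v_star_a, h.va_star, h.v_star_a,
      h.vc hq, h.v_star_c hq, ← h.av, h.ca hq, h.star_ca hq, h.star_c_star_a, h.c_star_a,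
      h.c_normal, aa, aa',
      l h.star_v_v, l h.v_star_v, l h.star_v_c, l h.star_v_star_c, l h.star_v_star_a,
      l h.va_star, l h.v_star_a, l (h.vc hq), l (h.v_star_c hq), l h.av.symm, l (h.ca hq),
      l (h.star_ca hq), l h.star_c_star_a, l h.c_star_a, l h.c_normal, l aa, l aa']
    all_goals match_scalars <;> field_simp <;> ring

end IsUqTriple

end

/-! ### Homomorphisms of universal C*-algebras -/

section Universal

theorem continuous_starAlgHom {A B : Type*} [CStarAlgebra A] [CStarAlgebra B] (φ : A →⋆ₐ[ℂ] B) :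
    Continuous φ :=
  AddMonoidHomClass.continuous_of_bound φ 1 fun x => by
    simpa using NonUnitalStarAlgHom.norm_apply_le φ x

variable {X : Type*} {R : Set (FreeStarAlgebra X)} {hR : BoundsGenerators R}

namespace UniversalCStar

/-- The image of the free `*`-algebra is dense and lies in any `*`-subalgebra that contains the
generators. -/
theorem starSubalgebra_eq_top {S : StarSubalgebra ℂ (UniversalCStar R hR)}
    (hS : IsClosed (S : Set (UniversalCStar R hR))) (hg : ∀ x, gen R hR x ∈ S) : S = ⊤ := by
  have h1 : ∀ a, CStarSeminorm.Completion.of (universalSeminorm R hR) a ∈ S := by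
    intro a
    induction a using FreeStarAlgebra.induction with
    | h_map c => rw [AlgHomClass.commutes]; exact S.algebraMap_mem c
    | h_letter s =>
      cases s with
      | inl x => exact hg x
      | inr x =>
        have h : (FreeStarAlgebra.letter (Sum.inr x) : FreeStarAlgebra X) =
            star (FreeStarAlgebra.gen x) := (FreeStarAlgebra.star_letter (Sum.inl x)).symm
        rw [h, map_star]
        exact star_mem (hg x)
    | h_mul a b ha hb => rw [map_mul]; exact S.mul_mem ha hb
    | h_add a b ha hb => rw [map_add]; exact S.add_mem ha hb
  refine SetLike.ext' ?_
  rw [← hS.closure_eq, StarSubalgebra.coe_top]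
  exact ((CStarSeminorm.Completion.denseRange_coe (universalSeminorm R hR)).mono
    (Set.range_subset_iff.2 h1)).closure_eq

theorem hom_ext {B : Type*} [CStarAlgebra B] {φ ψ : UniversalCStar R hR →⋆ₐ[ℂ] B}
    (h : ∀ x, φ (gen R hR x) = ψ (gen R hR x)) : φ = ψ := by
  have h1 : StarAlgHom.equalizer φ ψ = ⊤ :=
    starSubalgebra_eq_top (isClosed_eq (continuous_starAlgHom φ) (continuous_starAlgHom ψ)) h
  ext x
  have h2 : x ∈ StarAlgHom.equalizer φ ψ := h1 ▸ StarSubalgebra.mem_top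
  exact h2

/-- Centralizers are closed `*`-subalgebras. The centralizer of the generators is therefore
everything, which makes the generators central, and then the centre is everything as well. -/
theorem mul_comm_of_gen (h : ∀ x y, gen R hR x * gen R hR y = gen R hR y * gen R hR x)
    (h' : ∀ x y, star (gen R hR x) * gen R hR y = gen R hR y * star (gen R hR x))
    (a b : UniversalCStar R hR) : a * b = b * a := by
  have h1 : StarSubalgebra.centralizer ℂ (Set.range (gen R hR)) = ⊤ := by
    refine starSubalgebra_eq_top (Set.isClosed_centralizer _) fun y => ?_
    rw [StarSubalgebra.mem_centralizer_iff]
    rintro _ ⟨x, rfl⟩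
    exact ⟨h x y, h' x y⟩
  have h2 : StarSubalgebra.centralizer ℂ (Set.univ : Set (UniversalCStar R hR)) = ⊤ := by
    refine starSubalgebra_eq_top (Set.isClosed_centralizer _) fun y => ?_
    rw [StarSubalgebra.mem_centralizer_iff]
    intro g _
    have h3 : ∀ g : UniversalCStar R hR, g * gen R hR y = gen R hR y * g := fun g =>
      ((StarSubalgebra.mem_centralizer_iff ℂ).1 (h1 ▸ StarSubalgebra.mem_top : g ∈
        StarSubalgebra.centralizer ℂ (Set.range (gen R hR))) _ ⟨y, rfl⟩).1.symm
    exact ⟨h3 g, h3 (star g)⟩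
  exact ((StarSubalgebra.mem_centralizer_iff ℂ).1 (h2 ▸ StarSubalgebra.mem_top : b ∈
    StarSubalgebra.centralizer ℂ Set.univ) a trivial).1

end UniversalCStar

end Universal

/-! ### Comultiplications -/

section Comultiplication

variable {A B C D : Type} [CStarAlgebra A] [CStarAlgebra B] [CStarAlgebra C] [CStarAlgebra D]

theorem minTensorMap_minTmul (φ : A →⋆ₐ[ℂ] C) (ψ : B →⋆ₐ[ℂ] D) (a : A) (b : B) :
    minTensorMap φ ψ (minTmul a b) = minTmul (φ a) (ψ b) :=
  CStarSeminorm.Completion.lift_of _ _ _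

theorem minTmul_mul (a a' : A) (b b' : B) :
    minTmul a b * minTmul a' b' = minTmul (a * a') (b * b') := by
  rw [minTmul, minTmul, minTmul, ← map_mul, Algebra.TensorProduct.tmul_mul_tmul]

variable (A B) in
/-- The embedding `a ↦ a ⊗ 1`. -/
def minInl : A →⋆ₐ[ℂ] MinTensor A B :=
  (CStarSeminorm.Completion.of (minSeminorm A B)).comp
    { (Algebra.TensorProduct.includeLeft : A →ₐ[ℂ] A ⊗[ℂ] B) with
      map_star' := fun a => by
        show star a ⊗ₜ[ℂ] (1 : B) = star (a ⊗ₜ[ℂ] (1 : B))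
        rw [TensorProduct.star_tmul, star_one] }

variable (A B) in
/-- The embedding `b ↦ 1 ⊗ b`. -/
def minInr : B →⋆ₐ[ℂ] MinTensor A B :=
  (CStarSeminorm.Completion.of (minSeminorm A B)).comp
    { (Algebra.TensorProduct.includeRight : B →ₐ[ℂ] A ⊗[ℂ] B) with
      map_star' := fun b => by
        show (1 : A) ⊗ₜ[ℂ] star b = star ((1 : A) ⊗ₜ[ℂ] b)
        rw [TensorProduct.star_tmul, star_one] }

theorem minInl_apply (a : A) : minInl A B a = minTmul a 1 := rfl

theorem minInr_apply (b : B) : minInr A B b = minTmul 1 b := rfl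

theorem minTmul_zero_left (b : B) : minTmul (0 : A) b = 0 := by
  rw [minTmul, TensorProduct.zero_tmul, map_zero]

variable {E : Fin 3 → Fin 3 → Fin 3 → ℂ}

theorem isTwistedUnitary_woronowicz (E : Fin 3 → Fin 3 → Fin 3 → ℂ) :
    IsTwistedUnitary E (woronowicz E).u :=
  (forall_mem_woronowiczRelations (UniversalCStar.gen (woronowiczRelations E)
    (boundsGenerators_woronowiczRelations E))).1 fun _ hr => UniversalCStar.relation _ _ hr

/-- The matrix is the product of `u ⊗ 1` and `1 ⊗ u`, whose entries commute with each other. -/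
theorem isTwistedUnitary_minTmul {u : Fin 3 → Fin 3 → A} (h : IsTwistedUnitary E u) :
    IsTwistedUnitary E fun i j => ∑ k, minTmul (u i k) (u k j) := by
  have h1 := (h.map (minInl A A)).mul (h.map (minInr A A)) fun i j k l => by
    rw [minInl_apply, minInr_apply, minTmul_mul, minTmul_mul]
    simp only [one_mul, mul_one]
  simp_rw [minInl_apply, minInr_apply, minTmul_mul, one_mul, mul_one] at h1
  exact h1

theorem exists_isComultiplication_woronowicz (E : Fin 3 → Fin 3 → Fin 3 → ℂ) :
    ∃ Δ, IsComultiplication (woronowicz E) Δ :=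
  ⟨UniversalCStar.lift (boundsGenerators_woronowiczRelations E)
    (fun x => ∑ k, minTmul ((woronowicz E).u x.1 k) ((woronowicz E).u k x.2))
    ((forall_mem_woronowiczRelations _).2
      (isTwistedUnitary_minTmul (isTwistedUnitary_woronowicz E))),
    fun _ _ => UniversalCStar.lift_gen _ _ _ _⟩

/-- A comultiplication can be transported along an isomorphism of C*-algebras. -/
theorem isomorphic_of_starAlgEquiv {G K : MatrixPair} {Δ : G.A →⋆ₐ[ℂ] MinTensor G.A G.A}
    (hΔ : IsComultiplication G Δ) (Φ : G.A ≃⋆ₐ[ℂ] K.A)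
    (h : ∀ i j, minTensorMap (Φ : G.A →⋆ₐ[ℂ] K.A) (Φ : G.A →⋆ₐ[ℂ] K.A) (Δ (Φ.symm (K.u i j))) =
      ∑ k, minTmul (K.u i k) (K.u k j)) : Isomorphic G K := by
  -- The comultiplication of `K` is defined by conjugation with `Φ`, so intertwining is automatic
  -- and only its values on the matrix entries need checking.
  refine ⟨Δ, (minTensorMap (Φ : G.A →⋆ₐ[ℂ] K.A) (Φ : G.A →⋆ₐ[ℂ] K.A)).comp
    (Δ.comp (Φ.symm : K.A →⋆ₐ[ℂ] G.A)), Φ, hΔ, h, fun x => ?_⟩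
  show minTensorMap _ _ (Δ (Φ.symm (Φ x))) = _
  rw [StarAlgEquiv.symm_apply_apply]

end Comultiplication

/-! ### The isomorphism with `U_q(2)` -/

section Uq

variable {E : Fin 3 → Fin 3 → Fin 3 → ℂ}

theorem isUqTriple_gen {q : ℂ} (hq : q ≠ 0) :
    IsUqTriple q (UniversalCStar.gen _ (boundsGenerators_uqRelations q) UqGen.a)
      (UniversalCStar.gen _ _ UqGen.c) (UniversalCStar.gen _ _ UqGen.v) :=
  (forall_mem_uqRelations hq _).1 fun _ hr => UniversalCStar.relation _ _ hr

theorem isomorphic_uq2 (hE : IsSplitArray E) (hk : E 2 0 1 = -conj (uqParam E) * E 1 0 2) :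
    Isomorphic (woronowicz E) (Uq2 (uqParam E)) := by
  have hq := hE.uqParam_ne_zero
  have hu := isTwistedUnitary_woronowicz E
  have hU : IsTwistedUnitary E (uqMatrix (uqParam E)) :=
    (isUqTriple_gen hq).isTwistedUnitary hE hk
  let φ : WoronowiczAlgebra E →⋆ₐ[ℂ] UqAlgebra (uqParam E) :=
    UniversalCStar.lift _ (fun x => uqMatrix (uqParam E) x.1 x.2)
      ((forall_mem_woronowiczRelations _).2 hU)
  have hφ : ∀ i j, φ ((woronowicz E).u i j) = uqMatrix (uqParam E) i j := fun i j =>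
    UniversalCStar.lift_gen _ _ _ (i, j)
  let f : UqGen → WoronowiczAlgebra E := fun x => match x with
    | UqGen.a => (woronowicz E).u 1 1
    | UqGen.c => (woronowicz E).u 2 1
    | UqGen.v => (woronowicz E).u 0 0
  let ψ : UqAlgebra (uqParam E) →⋆ₐ[ℂ] WoronowiczAlgebra E :=
    UniversalCStar.lift _ f ((forall_mem_uqRelations hq f).2 (hu.isUqTriple hE))
  have hψ : ∀ x, ψ (UniversalCStar.gen _ _ x) = f x := UniversalCStar.lift_gen _ _ _
  -- The entries `(1,2)` and `(2,2)` are expressed through `a`, `c`, `v` by the same formulas in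
  -- both algebras.
  have hψu : ∀ i j, ψ (uqMatrix (uqParam E) i j) = (woronowicz E).u i j := by
    have h00 : ψ (uqMatrix (uqParam E) 0 0) = (woronowicz E).u 0 0 := hψ UqGen.v
    have h11 : ψ (uqMatrix (uqParam E) 1 1) = (woronowicz E).u 1 1 := hψ UqGen.a
    have h21 : ψ (uqMatrix (uqParam E) 2 1) = (woronowicz E).u 2 1 := hψ UqGen.c
    have h12 : ψ (uqMatrix (uqParam E) 1 2) = (woronowicz E).u 1 2 := by
      rw [hu.apply_one_two hE, ← h21, ← h00, ← map_star, ← map_star, ← map_mul, ← map_smul,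
        ← map_neg]
      rfl
    have h22 : ψ (uqMatrix (uqParam E) 2 2) = (woronowicz E).u 2 2 := by
      rw [hu.apply_two_two hE, ← h11, ← h00, ← map_star, ← map_star, ← map_mul]
      rfl
    have h01 : ψ (uqMatrix (uqParam E) 0 1) = (woronowicz E).u 0 1 := by
      rw [hu.apply_zero_one hE]; exact map_zero ψ
    have h02 : ψ (uqMatrix (uqParam E) 0 2) = (woronowicz E).u 0 2 := by
      rw [hu.apply_zero_two hE]; exact map_zero ψ
    have h10 : ψ (uqMatrix (uqParam E) 1 0) = (woronowicz E).u 1 0 := by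
      rw [hu.apply_one_zero hE]; exact map_zero ψ
    have h20 : ψ (uqMatrix (uqParam E) 2 0) = (woronowicz E).u 2 0 := by
      rw [hu.apply_two_zero hE]; exact map_zero ψ
    intro i j
    fin_cases i <;> fin_cases j <;> assumption
  let Φ : WoronowiczAlgebra E ≃⋆ₐ[ℂ] UqAlgebra (uqParam E) := StarAlgEquiv.ofStarAlgHom φ ψ
    (UniversalCStar.hom_ext fun x => (congrArg ψ (hφ x.1 x.2)).trans (hψu x.1 x.2))
    (UniversalCStar.hom_ext fun x => by
      show φ (ψ _) = _
      rw [hψ]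
      cases x <;> exact hφ _ _)
  obtain ⟨Δ, hΔ⟩ := exists_isComultiplication_woronowicz E
  refine isomorphic_of_starAlgEquiv hΔ Φ fun i j => ?_
  have h1 : Φ.symm ((Uq2 (uqParam E)).u i j) = (woronowicz E).u i j := hψu i j
  rw [h1, hΔ, map_sum]
  refine Finset.sum_congr rfl fun k _ => ?_
  rw [minTensorMap_minTmul]
  exact congrArg₂ _ (hφ i k) (hφ k j)

end Uq

/-! ### The isomorphism with the torus -/

section Torus

/-- A `*`-homomorphism out of a commutative C*-algebra through which all characters factor is
injective. -/
theorem injective_of_characters {A B : Type*} [CStarAlgebra A] [Ring B] [StarRing B] [Algebra ℂ B]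
    (comm : ∀ x y : A, x * y = y * x) (φ : A →⋆ₐ[ℂ] B)
    (h : ∀ χ : A →⋆ₐ[ℂ] ℂ, ∀ x, φ x = 0 → χ x = 0) : Function.Injective φ := by
  let _ : CommCStarAlgebra A := { (inferInstance : CStarAlgebra A) with mul_comm := comm }
  refine (injective_iff_map_eq_zero φ).2 fun x hx => ?_
  refine (injective_iff_map_eq_zero _).1 (gelfandTransform_bijective A).injective x ?_
  ext χ
  exact h (χ : A →⋆ₐ[ℂ] ℂ) x hx

/-- Where `E a b c` is nonzero, `a, b, c` is a permutation, so by commutativity the product of the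
diagonal entries does not depend on it. -/
theorem isTwistedUnitary_diagonal {B : Type*} [CommRing B] [StarRing B] [Algebra ℂ B]
    {E : Fin 3 → Fin 3 → Fin 3 → ℂ} (hE : PermutationCondition E) {z : Fin 3 → B}
    (hz : ∀ i, star (z i) * z i = 1) (hprod : z 0 * z 1 * z 2 = 1) :
    IsTwistedUnitary E (Matrix.diagonal z) where
  row j k := by
    rw [Finset.sum_eq_single j (fun i _ hij => by simp [Matrix.diagonal_apply_ne' _ hij])
      (by simp)]
    by_cases hjk : j = k
    · subst hjk; simp [mul_comm (z j), hz]
    · simp [Matrix.diagonal_apply_ne' _ hjk, hjk]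
  col j k := by
    rw [Finset.sum_eq_single j (fun i _ hij => by simp [Matrix.diagonal_apply_ne _ hij])
      (by simp)]
    by_cases hjk : j = k
    · subst hjk; simp [hz]
    · simp [hjk]
  det a b c := by
    have h1 : ∑ i, ∑ j, ∑ k, E i j k •
        (Matrix.diagonal z a i * Matrix.diagonal z b j * Matrix.diagonal z c k) =
        E a b c • (z a * z b * z c) := by
      rw [Finset.sum_eq_single a (fun i _ hi => by simp [Matrix.diagonal_apply_ne' _ hi])
        (by simp),
        Finset.sum_eq_single b (fun i _ hi => by simp [Matrix.diagonal_apply_ne' _ hi])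
        (by simp),
        Finset.sum_eq_single c (fun i _ hi => by simp [Matrix.diagonal_apply_ne' _ hi])
        (by simp)]
      simp
    rw [h1]
    by_cases h0 : E a b c = 0
    · rw [h0, zero_smul, zero_smul]
    · have hb := (hE a b c).1 h0
      have h2 := hb.prod_comp z
      rw [Fin.prod_univ_three, Fin.prod_univ_three, hprod] at h2
      exact congrArg _ h2

variable {E : Fin 3 → Fin 3 → Fin 3 → ℂ}

section

variable {B : Type*} [Ring B] [StarRing B] [Algebra ℂ B] [StarModule ℂ B] {u : Fin 3 → Fin 3 → B}

theorem IsTwistedUnitary.eq_diagonal (h : IsTwistedUnitary E u) (hE : IsSplitArray E)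
    (h21 : u 2 1 = 0) :
    u = Matrix.diagonal ![u 0 0, u 1 1, star (u 1 1) * star (u 0 0)] := by
  have h12 := h.apply_one_two hE
  rw [h21, star_zero, zero_mul, smul_zero, neg_zero] at h12
  ext i j
  fin_cases i <;> fin_cases j <;>
    simp [h21, h12, h.apply_zero_one hE, h.apply_zero_two hE, h.apply_one_zero hE,
      h.apply_two_zero hE, h.apply_two_two hE]

/-- With `c = 0` the relations of the triple say that `a` and `v` are commuting unitaries, and all
entries of `u` lie in the `*`-algebra that they generate. -/
theorem IsTwistedUnitary.mul_comm_of_apply_two_one (h : IsTwistedUnitary E u)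
    (hE : IsSplitArray E) (h21 : u 2 1 = 0) (i j k l : Fin 3) :
    u i j * u k l = u k l * u i j ∧ star (u i j) * u k l = u k l * star (u i j) := by
  have ht := h.isUqTriple hE
  have ha := ht.a_star_a
  have ha' := ht.star_a_a
  simp only [h21, mul_zero, smul_zero, add_zero] at ha ha'
  have comm : ∀ x ∈ ({u 0 0, u 1 1} : Set B), ∀ y ∈ ({u 0 0, u 1 1} : Set B), x * y = y * x := by
    rintro x (rfl | rfl) y (rfl | rfl)
    exacts [rfl, ht.av.symm, ht.av, rfl]
  have comm_star : ∀ x ∈ ({u 0 0, u 1 1} : Set B), ∀ y ∈ ({u 0 0, u 1 1} : Set B),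
      x * star y = star y * x := by
    rintro x (rfl | rfl) y (rfl | rfl)
    exacts [ht.v_star_v.trans ht.star_v_v.symm, ht.v_star_a, ht.va_star.symm, ha.trans ha'.symm]
  have mem : ∀ i j, u i j ∈ StarAlgebra.adjoin ℂ ({u 0 0, u 1 1} : Set B) := by
    have m0 : u 0 0 ∈ StarAlgebra.adjoin ℂ ({u 0 0, u 1 1} : Set B) :=
      StarAlgebra.subset_adjoin ℂ _ (by simp)
    have m1 : u 1 1 ∈ StarAlgebra.adjoin ℂ ({u 0 0, u 1 1} : Set B) :=
      StarAlgebra.subset_adjoin ℂ _ (by simp)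
    intro i j
    rw [h.eq_diagonal hE h21]
    by_cases hij : i = j
    · subst hij
      rw [Matrix.diagonal_apply_eq]
      fin_cases i
      exacts [m0, m1, mul_mem (star_mem m1) (star_mem m0)]
    · rw [Matrix.diagonal_apply_ne _ hij]
      exact zero_mem _
  have key : ∀ x ∈ StarAlgebra.adjoin ℂ ({u 0 0, u 1 1} : Set B),
      ∀ y ∈ StarAlgebra.adjoin ℂ ({u 0 0, u 1 1} : Set B), x * y = y * x := fun x hx y hy =>
    congrArg Subtype.val ((StarAlgebra.isMulCommutative_adjoin ℂ comm comm_star).is_comm.comm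
      ⟨x, hx⟩ ⟨y, hy⟩)
  exact ⟨key _ (mem i j) _ (mem k l), key _ (star_mem (mem i j)) _ (mem k l)⟩

end

/-- The coordinate functions of the torus and the inverse of their product. -/
def torusCoord : Fin 3 → C(Circle × Circle, ℂ) :=
  ![⟨fun z => (z.1 : ℂ), by fun_prop⟩, ⟨fun z => (z.2 : ℂ), by fun_prop⟩,
    ⟨fun z => conj (z.2 : ℂ) * conj (z.1 : ℂ), by fun_prop⟩]

theorem isTwistedUnitary_torusCoord (hE : PermutationCondition E) :
    IsTwistedUnitary E (Matrix.diagonal torusCoord) := by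
  have h : ∀ z : Circle, conj (z : ℂ) * z = 1 := fun z => by
    rw [Complex.conj_mul', Circle.norm_coe]; simp
  refine isTwistedUnitary_diagonal hE (fun i => ?_) ?_
  · ext z
    fin_cases i
    · exact h z.1
    · exact h z.2
    · show conj (conj (z.2 : ℂ) * conj (z.1 : ℂ)) * (conj (z.2 : ℂ) * conj (z.1 : ℂ)) = 1
      rw [map_mul, Complex.conj_conj, Complex.conj_conj]
      linear_combination (conj (z.1 : ℂ) * z.1) * h z.2 + h z.1
  · ext z
    show (z.1 : ℂ) * z.2 * (conj (z.2 : ℂ) * conj (z.1 : ℂ)) = 1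
    linear_combination (conj (z.1 : ℂ) * z.1) * h z.2 + h z.1

theorem woronowicz_gen (x : Fin 3 × Fin 3) : UniversalCStar.gen (woronowiczRelations E)
    (boundsGenerators_woronowiczRelations E) x = (woronowicz E).u x.1 x.2 := rfl

theorem woronowicz_mul_comm (hE : IsSplitArray E) (h21 : (woronowicz E).u 2 1 = 0)
    (x y : WoronowiczAlgebra E) : x * y = y * x := by
  have hu := isTwistedUnitary_woronowicz E
  refine UniversalCStar.mul_comm_of_gen (fun x y => ?_) (fun x y => ?_) x y
  · rw [woronowicz_gen, woronowicz_gen]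
    exact (hu.mul_comm_of_apply_two_one hE h21 x.1 x.2 y.1 y.2).1
  · rw [woronowicz_gen, woronowicz_gen]
    exact (hu.mul_comm_of_apply_two_one hE h21 x.1 x.2 y.1 y.2).2

theorem exists_torusHom (hE : PermutationCondition E) :
    ∃ φ : WoronowiczAlgebra E →⋆ₐ[ℂ] C(Circle × Circle, ℂ),
      ∀ i j, φ ((woronowicz E).u i j) = Matrix.diagonal torusCoord i j :=
  ⟨UniversalCStar.lift _ (fun x => Matrix.diagonal torusCoord x.1 x.2)
    ((forall_mem_woronowiczRelations _).2 (isTwistedUnitary_torusCoord hE)),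
    fun i j => UniversalCStar.lift_gen _ _ _ (i, j)⟩

/-- A character sends the unitaries `v` and `a` to a point `p` of the torus and is determined by
these two values; hence it is `φ` followed by evaluation at `p`. -/
theorem torusHom_injective (hE : IsSplitArray E) (h21 : (woronowicz E).u 2 1 = 0)
    {φ : WoronowiczAlgebra E →⋆ₐ[ℂ] C(Circle × Circle, ℂ)}
    (hφ : ∀ i j, φ ((woronowicz E).u i j) = Matrix.diagonal torusCoord i j) :
    Function.Injective φ := by
  have hu := isTwistedUnitary_woronowicz E
  have hdiag := hu.eq_diagonal hE h21
  refine injective_of_characters (woronowicz_mul_comm hE h21) φ fun χ x hx => ?_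
  have norm_eq : ∀ w, star w * w = 1 → ‖χ w‖ = 1 := fun w hw => by
    have h1 := congrArg χ hw
    rw [map_mul, map_star, map_one, Complex.star_def, Complex.conj_mul'] at h1
    have h2 : ‖χ w‖ ^ 2 = 1 := by exact_mod_cast h1
    exact (pow_eq_one_iff_of_nonneg (norm_nonneg _) two_ne_zero).1 h2
  have ha := (hu.isUqTriple hE).star_a_a
  rw [h21, mul_zero, add_zero] at ha
  let p : Circle × Circle :=
    (⟨χ ((woronowicz E).u 0 0), mem_sphere_zero_iff_norm.2
      (norm_eq _ (hu.star_mul_self_zero_zero hE))⟩,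
    ⟨χ ((woronowicz E).u 1 1), mem_sphere_zero_iff_norm.2 (norm_eq _ ha)⟩)
  have hχ : χ = (ContinuousMap.evalStarAlgHom ℂ ℂ p).comp φ := by
    refine UniversalCStar.hom_ext fun x => ?_
    rw [woronowicz_gen]
    show χ ((woronowicz E).u x.1 x.2) = φ ((woronowicz E).u x.1 x.2) p
    rw [hφ]
    obtain ⟨i, j⟩ := x
    rw [hdiag]
    by_cases hij : i = j
    · subst hij
      rw [Matrix.diagonal_apply_eq, Matrix.diagonal_apply_eq]
      fin_cases i
      · rfl
      · rfl
      · show χ (star _ * star _) = _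
        rw [map_mul, map_star, map_star]
        rfl
    · rw [Matrix.diagonal_apply_ne _ hij, Matrix.diagonal_apply_ne _ hij, map_zero]
      rfl
  rw [hχ]
  show φ x p = 0
  rw [hx]
  rfl

/-- An injective `*`-homomorphism is isometric, so the range is closed; it contains both coordinate
functions, which separate points, and Stone–Weierstrass applies. -/
theorem torusHom_surjective {φ : WoronowiczAlgebra E →⋆ₐ[ℂ] C(Circle × Circle, ℂ)}
    (hφ : ∀ i j, φ ((woronowicz E).u i j) = Matrix.diagonal torusCoord i j)
    (inj : Function.Injective φ) : Function.Surjective φ := by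
  have hcl : IsClosed (φ.range : Set C(Circle × Circle, ℂ)) :=
    (NonUnitalStarAlgHom.isometry φ inj).isClosedEmbedding.isClosed_range
  have hsep : φ.range.SeparatesPoints := by
    intro z w hzw
    by_cases h1 : z.1 = w.1
    · refine ⟨_, ⟨_, ⟨(woronowicz E).u 1 1, rfl⟩, rfl⟩, ?_⟩
      show φ ((woronowicz E).u 1 1) z ≠ φ ((woronowicz E).u 1 1) w
      rw [hφ]
      exact fun h2 => hzw (Prod.ext h1 (Circle.ext h2))
    · refine ⟨_, ⟨_, ⟨(woronowicz E).u 0 0, rfl⟩, rfl⟩, ?_⟩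
      show φ ((woronowicz E).u 0 0) z ≠ φ ((woronowicz E).u 0 0) w
      rw [hφ]
      exact fun h2 => h1 (Circle.ext h2)
  have htop := ContinuousMap.starSubalgebra_topologicalClosure_eq_top_of_separatesPoints _ hsep
  intro f
  have hf : f ∈ φ.range.topologicalClosure := htop ▸ StarSubalgebra.mem_top
  rw [← SetLike.mem_coe, StarSubalgebra.topologicalClosure_coe, hcl.closure_eq] at hf
  exact hf

theorem isomorphic_torus2 (hE : IsSplitArray E) (hk : E 2 0 1 ≠ -conj (uqParam E) * E 1 0 2) :
    Isomorphic (woronowicz E) torus2 := by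
  obtain ⟨φ, hφ⟩ := exists_torusHom hE.perm
  have inj := torusHom_injective hE ((isTwistedUnitary_woronowicz E).apply_two_one hE hk) hφ
  have surj := torusHom_surjective hφ inj
  obtain ⟨Δ, hΔ⟩ := exists_isComultiplication_woronowicz E
  let Φ : WoronowiczAlgebra E ≃⋆ₐ[ℂ] C(Circle × Circle, ℂ) := .ofBijective φ ⟨inj, surj⟩
  -- The torus matrix is the upper left corner of the diagonal 3×3 matrix; the third diagonal entry
  -- is the inverse of the product of the other two.
  have hΦ : ∀ i j : Fin 2, φ ((woronowicz E).u i.castSucc j.castSucc) = torus2.u i j := by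
    intro i j
    rw [hφ]
    fin_cases i <;> fin_cases j <;> rfl
  refine isomorphic_of_starAlgEquiv hΔ Φ fun i j => ?_
  have h1 : Φ.symm (torus2.u i j) = (woronowicz E).u i.castSucc j.castSucc := by
    rw [← hΦ]
    exact Φ.symm_apply_apply _
  rw [h1, hΔ, map_sum]
  simp_rw [minTensorMap_minTmul]
  -- The sum over three indices has one term more than the torus requires; that term contains an
  -- off-diagonal entry and vanishes.
  refine (Fin.sum_univ_castSucc _).trans ?_
  have h2 : φ ((woronowicz E).u i.castSucc (Fin.last 2)) = 0 := by
    rw [hφ, Matrix.diagonal_apply_ne _ (Fin.castSucc_ne_last i)]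
  have h3 : minTmul (φ ((woronowicz E).u i.castSucc (Fin.last 2)))
      (φ ((woronowicz E).u (Fin.last 2) j.castSucc)) = 0 := by
    rw [h2, minTmul_zero_left]
  refine (congrArg₂ (· + ·) (Finset.sum_congr rfl fun k _ => ?_) h3).trans (add_zero _)
  exact congrArg₂ minTmul (hΦ i k) (hΦ k j)

end Torus

end PWQuantum

end

theorem mainTheorem12 (E : Fin 3 → Fin 3 → Fin 3 → ℂ)
    (hE : PWQuantum.PermutationCondition E)
    (h23 : PWQuantum.charConst E 1 2 = 1) (h13 : PWQuantum.charConst E 0 2 ≠ 1) :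
    (∃ q : ℂ, q ≠ 0 ∧ PWQuantum.Isomorphic (PWQuantum.woronowicz E) (PWQuantum.Uq2 q)) ∨
      PWQuantum.Isomorphic (PWQuantum.woronowicz E) PWQuantum.torus2 := by
  have h := PWQuantum.IsSplitArray.of_charConst hE h23 h13
  -- This equation holds exactly when the two evaluations of `v u_12` agree, so that `c` is not
  -- forced to vanish by them.
  by_cases hk : E 2 0 1 = -(starRingEnd ℂ) (PWQuantum.uqParam E) * E 1 0 2
  · exact .inl ⟨_, h.uqParam_ne_zero, PWQuantum.isomorphic_uq2 h hk⟩
  · exact .inr (PWQuantum.isomorphic_torus2 h hk)
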